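/- Let $C\subseteq\mathbb{R}^m$ and $D\subseteq\mathbb{R}^n$ be closed convex cones. For a closed convex cone $K\subseteq\mathbb{R}^k$ let $\Pi_K(y)$ denote the point of $K$ nearest to $y$ in the Euclidean norm, and let $w(K)=\mathbb{E}\,\|\Pi_K(g)\|$ with $g\sim N(0,I_k)$ be its Gaussian width. For $A\in\mathbb{R}^{n\times m}$ let $\|A\|$ be the operator norm with respect to the Euclidean norms, let $$\sigma_{C\to D}(A)=\min_{x\in C,\ \|x\|=1}\|\Pi_D(Ax)\|,$$ and define $\sigma_{D\to C}(-A^T)$ in the same way. Renegar's condition number is $$\mathcal{R}_{C,D}(A)=\min\Big\{\frac{\|A\|}{\sigma_{C\to D}(A)},\ \frac{\|A\|}{\sigma_{D\to C}(-A^T)}\Big\}\in[0,\infty],$$ where a quotient with denominator $0$ is read as $\infty$, the minimum over the empty set (which occurs only for a cone $\{0\}$) as $\infty$, and a quotient with denominator $\infty$ as $0$. Assume that $w(D)-w(C)>2\sqrt2$, and let $G$ be a random $n\times m$ matrix whose entries are independent standard normal variables. Put $$\varepsilon=2e^{-(w(D)-w(C))^2/8},$$ $$a=\tfrac12\big(w(\mathbb{R}^m)+w(\mathbb{R}^n)+w(D)-w(C)\big),\qquad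 b=\tfrac12\big(w(\mathbb{R}^m)+w(\mathbb{R}^n)-(w(D)-w(C))\big).$$ Then there exists a measurable set $E\subseteq\mathbb{R}^{n\times m}$ with $\mathbb{P}\{G\in E\}<\varepsilon$ such that $$\mathbb{E}\big[\mathcal{R}_{C,D}(G)\,\big|\,G\notin E\big]<\frac{1}{1-\varepsilon}\bigg(\frac{w(\mathbb{R}^n)+w(\mathbb{R}^m)}{w(D)-w(C)}+4\int_{b/a}^{(a+b)/(2a)}\frac{e^{-(as-b)^2/2}}{(1-s)^2}\,ds\bigg).$$ -/

import Mathlib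

open MeasureTheory ProbabilityTheory
open scoped ENNReal

noncomputable section

namespace Renegar

/-- The Borel σ-algebra on `n × m` real matrices, that is, the product σ-algebra of the entries. -/
instance instMeasurableSpaceMatrix {n m : ℕ} : MeasurableSpace (Matrix (Fin n) (Fin m) ℝ) :=
  inferInstanceAs (MeasurableSpace (Fin n → Fin m → ℝ))

/-- A closed convex cone contains a nearest point to every vector. -/
theorem exists_nearest {k : ℕ} (C : ProperCone ℝ (EuclideanSpace ℝ (Fin k)))
    (y : EuclideanSpace ℝ (Fin k)) :
    ∃ z ∈ C, ∀ w ∈ C, ‖y - z‖ ≤ ‖y - w‖ := by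
  obtain ⟨z, hz, h⟩ :=
    exists_norm_eq_iInf_of_complete_convex C.nonempty C.isClosed.isComplete C.convex y
  refine ⟨z, hz, fun w hw => ?_⟩
  rw [h]
  exact ciInf_le ⟨0, Set.forall_mem_range.2 fun _ => norm_nonneg _⟩
    (⟨w, hw⟩ : (C : Set (EuclideanSpace ℝ (Fin k))))

/-- The metric projection `Π_C(y) = argmin {‖y - z‖ | z ∈ C}` onto the closed convex cone `C`
(a `ProperCone` in Mathlib is a closed convex cone containing `0`; it may contain lines). -/
def proj {k : ℕ} (C : ProperCone ℝ (EuclideanSpace ℝ (Fin k))) (y : EuclideanSpace ℝ (Fin k)) :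
    EuclideanSpace ℝ (Fin k) :=
  Classical.choose (exists_nearest C y)

/-- The Gaussian width `w(C) = 𝔼 ‖Π_C(g)‖`, where `g ∼ N(0, I_k)`. -/
def gaussianWidth {k : ℕ} (C : ProperCone ℝ (EuclideanSpace ℝ (Fin k))) : ℝ :=
  ∫ g, ‖proj C g‖ ∂(stdGaussian (EuclideanSpace ℝ (Fin k)))

/-- The operator norm of `A : ℝᵐ → ℝⁿ` with respect to the Euclidean norms. -/
def opNorm {n m : ℕ} (A : Matrix (Fin n) (Fin m) ℝ) : ℝ≥0∞ :=
  ‖LinearMap.toContinuousLinearMap (Matrix.toEuclideanLin A)‖ₑ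

/-- The smallest restricted singular value
`σ_{C → D}(A) = min {‖Π_D(A x)‖ | x ∈ C, ‖x‖ = 1}`, equal to `∞` if `C = {0}`. -/
def minSing {n m : ℕ} (C : ProperCone ℝ (EuclideanSpace ℝ (Fin m)))
    (D : ProperCone ℝ (EuclideanSpace ℝ (Fin n))) (A : Matrix (Fin n) (Fin m) ℝ) : ℝ≥0∞ :=
  ⨅ x ∈ {x : EuclideanSpace ℝ (Fin m) | x ∈ C ∧ ‖x‖ = 1}, ‖proj D (Matrix.toEuclideanLin A x)‖ₑ

open Classical in
/-- The quotient `x / s` in `[0, ∞]` with `x / 0 = ∞` for all `x`, also for `x = 0`. -/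
def quot (x s : ℝ≥0∞) : ℝ≥0∞ := if s = 0 then ⊤ else x / s

/-- Renegar's condition number of the biconic feasibility problem,
`R_{C,D}(A) = min {‖A‖ / σ_{C → D}(A), ‖A‖ / σ_{D → C}(-Aᵀ)}`, with values in `[0, ∞]`. -/
def condNumber {n m : ℕ} (C : ProperCone ℝ (EuclideanSpace ℝ (Fin m)))
    (D : ProperCone ℝ (EuclideanSpace ℝ (Fin n))) (A : Matrix (Fin n) (Fin m) ℝ) : ℝ≥0∞ :=
  min (quot (opNorm A) (minSing C D A)) (quot (opNorm A) (minSing D C (-A.transpose)))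

/-- `G` is a Gaussian random matrix: its entries are independent standard normal variables. -/
structure IsGaussianMatrix {Ω : Type*} [MeasurableSpace Ω] {n m : ℕ}
    (G : Ω → Matrix (Fin n) (Fin m) ℝ) (P : Measure Ω) : Prop where
  measurable : Measurable G
  hasLaw : ∀ i j, HasLaw (fun ω => G ω i j) (gaussianReal 0 1) P
  indep : iIndepFun (fun (p : Fin n × Fin m) ω => G ω p.1 p.2) P

end Renegar

end

noncomputable section

namespace Renegar

open Filter Topology
open scoped RealInnerProductSpace

/-! Write W for the sum of the widths of the two full spaces and δ for w(D) - w(C). Only the first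
quotient of the condition number is needed: it bounds the minimum from above. So the task is to
bound the mean of ‖G‖ / σ(G), with σ the restricted singular value from C to D, away from the event
that the numerator is large or the denominator small.

Both quantities are sub-Gaussian with variance proxy 1 on the relevant side: for t > 0, 𝔼 exp(t‖G‖)
≤ exp(tW + t²/2) and 𝔼 exp(-tσ(G)) ≤ exp(-tδ + t²/2) (`lintegral_exp_realOpNorm_le`,
`lintegral_exp_neg_realSing_le`). The source is Gordon's min-max comparison of ⟪y, Gx⟫ + γ with ⟪y,
g⟫ - ⟪x, h⟫ (`measureReal_le_of_gordon`), proved by Gaussian interpolation and Stein's identity.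
Passing to exponential moments splits the comparison process into norms of projections of g and h.
Each of these is 1-Lipschitz and so sub-Gaussian with proxy 1 (`lintegral_exp_norm_proj_le`), which
gives exp(t²/2) twice. The auxiliary variable γ contributes exp(t²/2) on the other side and cancels
one of the two factors; this keeps the proxy at 1 rather than 2.

Chernoff's bound then gives tails exp(-r²/2). Take E to be the event that ‖G‖ ≥ W + δ/2 or σ(G) ≤
δ/2; its probability is below 2 exp(-δ²/8) = ε. Off E the quotient is at most (W + T) / (δ - T),
where T < δ/2 is the larger of the two deviations. Writing this as W/δ plus the integral of its
derivative, the layer-cake formula and the tail 2 exp(-r²/2) of T produce the stated integral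
(`setLIntegral_le_of_tail`). Conditioning divides by ℙ(Eᶜ) > 1 - ε. The strictness comes from a
strict Chernoff bound. -/

/-! ### Stein's identity and Gaussian interpolation. -/

theorem hasDerivAt_gaussianPDFReal (x : ℝ) :
    HasDerivAt (gaussianPDFReal 0 1) (-(x * gaussianPDFReal 0 1 x)) x := by
  unfold gaussianPDFReal
  have h : HasDerivAt (fun x : ℝ => -(x - 0) ^ 2 / (2 * ((1 : NNReal) : ℝ))) (-x) x := by
    have := (((hasDerivAt_id x).sub_const 0).pow 2).neg.div_const (2 * ((1 : NNReal) : ℝ))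
    refine this.congr_deriv ?_
    simp
    ring
  refine (h.exp.const_mul _).congr_deriv ?_
  ring

theorem integrable_mul_gaussianPDFReal :
    Integrable (fun x : ℝ => x * gaussianPDFReal 0 1 x) := by
  have h := (integrable_mul_exp_neg_mul_sq (b := 1 / 2) (by norm_num)).const_mul
    ((Real.sqrt (2 * Real.pi * ((1 : NNReal) : ℝ)))⁻¹)
  refine h.congr (ae_of_all _ fun x => ?_)
  simp only [gaussianPDFReal]
  rw [show -(x - 0) ^ 2 / (2 * ((1 : NNReal) : ℝ)) = -(1 / 2) * x ^ 2 by simp; ring]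
  ring

/-- Stein's identity for a standard normal variable. -/
theorem integral_id_mul_gaussianReal {f f' : ℝ → ℝ} {A A' : ℝ}
    (hf : ∀ x, HasDerivAt f (f' x) x) (hfA : ∀ x, |f x| ≤ A) (hfA' : ∀ x, |f' x| ≤ A') :
    ∫ x, x * f x ∂(gaussianReal 0 1) = ∫ x, f' x ∂(gaussianReal 0 1) := by
  have hfc : Continuous f := continuous_iff_continuousAt.2 fun x => (hf x).continuousAt
  have hf'm : Measurable f' := by
    rw [show f' = deriv f from funext fun x => (hf x).deriv.symm]
    exact measurable_deriv f
  rw [integral_gaussianReal_eq_integral_smul one_ne_zero,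
    integral_gaussianReal_eq_integral_smul one_ne_zero]
  have h := integral_mul_deriv_eq_deriv_mul_of_integrable (u := f) (u' := f')
    (v := gaussianPDFReal 0 1) (v' := fun x => -(x * gaussianPDFReal 0 1 x))
    (fun x _ => hf x) (fun x _ => hasDerivAt_gaussianPDFReal x)
    (integrable_mul_gaussianPDFReal.neg.bdd_mul hfc.aestronglyMeasurable (ae_of_all _ hfA))
    ((integrable_gaussianPDFReal 0 1).bdd_mul hf'm.aestronglyMeasurable (ae_of_all _ hfA'))
    ((integrable_gaussianPDFReal 0 1).bdd_mul hfc.aestronglyMeasurable (ae_of_all _ hfA))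
  rw [← neg_inj, ← integral_neg] at h
  simp only [smul_eq_mul]
  convert h using 1
  · exact integral_congr_ae (ae_of_all _ fun x => by ring)
  · rw [neg_neg]
    exact integral_congr_ae (ae_of_all _ fun x => by ring)

/-- The standard Gaussian measure on `ι → ℝ`. -/
abbrev stdPi (ι : Type*) [Fintype ι] : Measure (ι → ℝ) := Measure.pi fun _ => gaussianReal 0 1

/-- Resampling one coordinate preserves a product of probability measures. -/
theorem measurePreserving_update {ι : Type*} [Fintype ι] [DecidableEq ι] (k : ι) :
    MeasurePreserving (fun p : (ι → ℝ) × ℝ => Function.update p.1 k p.2)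
      ((stdPi ι).prod (gaussianReal 0 1)) (stdPi ι) := by
  have hm : Measurable fun p : (ι → ℝ) × ℝ => Function.update p.1 k p.2 := by
    refine measurable_pi_lambda _ fun i => ?_
    by_cases h : i = k
    · subst h; simpa using measurable_snd
    · simp only [Function.update_of_ne h]; fun_prop
  refine ⟨hm, (Measure.pi_eq fun s hs => ?_).symm⟩
  rw [Measure.map_apply hm (MeasurableSet.univ_pi hs)]
  have : (fun p : (ι → ℝ) × ℝ => Function.update p.1 k p.2) ⁻¹' Set.univ.pi s =
      (Set.univ.pi (Function.update s k Set.univ)) ×ˢ (s k) := by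
    ext p
    simp only [Set.mem_preimage, Set.mem_univ_pi, Set.mem_prod]
    constructor
    · intro h
      refine ⟨fun i => ?_, by simpa using h k⟩
      by_cases hi : i = k
      · subst hi; simp
      · simpa [Function.update_of_ne hi] using h i
    · rintro ⟨h1, h2⟩ i
      by_cases hi : i = k
      · subst hi; simpa using h2
      · simpa [Function.update_of_ne hi] using h1 i
  rw [this, Measure.prod_prod, Measure.pi_pi, ← Finset.prod_erase_mul _ _ (Finset.mem_univ k),
    ← Finset.prod_erase_mul _ _ (Finset.mem_univ k)]
  simp only [Function.update_self, measure_univ, mul_one]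
  congr 1
  exact Finset.prod_congr rfl fun i hi => by rw [Function.update_of_ne (Finset.ne_of_mem_erase hi)]

theorem integrable_eval_stdPi {ι : Type*} [Fintype ι] (k : ι) :
    Integrable (fun x => x k) (stdPi ι) :=
  integrable_eval (μ := fun _ : ι => gaussianReal 0 1) (i := k) IsGaussian.integrable_id

/-- Stein's identity for a coordinate of a standard Gaussian vector. -/
theorem integral_eval_mul_stdPi {ι : Type*} [Fintype ι] [DecidableEq ι] (k : ι)
    {f f' : (ι → ℝ) → ℝ} {A A' : ℝ} (hfm : Measurable f) (hfm' : Measurable f')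
    (hf : ∀ x, HasDerivAt (fun s => f (Function.update x k s)) (f' x) (x k))
    (hfA : ∀ x, |f x| ≤ A) (hfA' : ∀ x, |f' x| ≤ A') :
    ∫ x, x k * f x ∂(stdPi ι) = ∫ x, f' x ∂(stdPi ι) := by
  have hp := measurePreserving_update k
  have h1 : Integrable (fun x : ι → ℝ => x k * f x) (stdPi ι) :=
    (integrable_eval_stdPi k).mul_bdd hfm.aestronglyMeasurable (ae_of_all _ hfA)
  have h2 : Integrable f' (stdPi ι) :=
    Integrable.of_bound hfm'.aestronglyMeasurable A' (ae_of_all _ hfA')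
  -- Resampling coordinate `k` and applying Fubini freezes the other coordinates, so the
  -- one-dimensional identity applies in the inner integral.
  rw [← hp.map_eq, integral_map hp.aemeasurable (by rw [hp.map_eq]; exact h1.1),
    integral_map hp.aemeasurable (by rw [hp.map_eq]; exact h2.1),
    integral_prod (fun p : (ι → ℝ) × ℝ => Function.update p.1 k p.2 k *
      f (Function.update p.1 k p.2)) (hp.integrable_comp_of_integrable h1),
    integral_prod (fun p : (ι → ℝ) × ℝ => f' (Function.update p.1 k p.2))
      (hp.integrable_comp_of_integrable h2)]
  refine integral_congr_ae (ae_of_all _ fun x => ?_)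
  simp only [Function.update_self]
  refine integral_id_mul_gaussianReal (A := A) (A' := A') (fun s => ?_) (fun s => hfA _)
    fun s => hfA' _
  have := hf (Function.update x k s)
  simpa using this

/-- Gaussian interpolation: the derivative of `𝔼 F(Z ξ)` along a path of matrices `Z`, for a
function `F` of class `C²` with bounded partial derivatives `F₁ a` and `F₂ a b`. -/
theorem hasDerivAt_integral_stdPi {ι κ : Type*} [Fintype ι] [Fintype κ]
    {F : (ι → ℝ) → ℝ} {F₁ : ι → (ι → ℝ) → ℝ} {F₂ : ι → ι → (ι → ℝ) → ℝ} {A₀ A₁ A₂ : ℝ}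
    (hFm : Measurable F) (hFm₁ : ∀ a, Measurable (F₁ a)) (hFm₂ : ∀ a b, Measurable (F₂ a b))
    (hF₁ : ∀ (c : ℝ → ι → ℝ) (c' : ι → ℝ) (t : ℝ), (∀ a, HasDerivAt (fun s => c s a) (c' a) t) →
      HasDerivAt (fun s => F (c s)) (∑ a, F₁ a (c t) * c' a) t)
    (hF₂ : ∀ a (c : ℝ → ι → ℝ) (c' : ι → ℝ) (t : ℝ), (∀ a, HasDerivAt (fun s => c s a) (c' a) t) →
      HasDerivAt (fun s => F₁ a (c s)) (∑ b, F₂ a b (c t) * c' b) t)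
    (hA₀ : ∀ z, |F z| ≤ A₀) (hA₁ : ∀ a z, |F₁ a z| ≤ A₁) (hA₂ : ∀ a b z, |F₂ a b z| ≤ A₂)
    {Z Z' : ℝ → ι → κ → ℝ} {B : ℝ} (hZ : ∀ t a k, HasDerivAt (fun s => Z s a k) (Z' t a k) t)
    (hB : ∀ t a k, |Z' t a k| ≤ B) (t : ℝ) :
    HasDerivAt (fun s => ∫ x, F (fun a => ∑ k, Z s a k * x k) ∂(stdPi κ))
      (∑ a, ∑ b, (∑ k, Z' t a k * Z t b k) *
        ∫ x, F₂ a b (fun a => ∑ k, Z t a k * x k) ∂(stdPi κ)) t := by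
  classical
  have hlin : ∀ s, Measurable fun (x : κ → ℝ) (a : ι) => ∑ k, Z s a k * x k := fun s => by fun_prop
  have hcurve : ∀ (x : κ → ℝ) s a,
      HasDerivAt (fun s => ∑ k, Z s a k * x k) (∑ k, Z' s a k * x k) s := fun x s a =>
    HasDerivAt.fun_sum fun k _ => (hZ s a k).mul_const _
  have hmain := (hasDerivAt_integral_of_dominated_loc_of_deriv_le (μ := stdPi κ)
    (F := fun s x => F (fun a => ∑ k, Z s a k * x k))
    (F' := fun s x => ∑ a, F₁ a (fun a => ∑ k, Z s a k * x k) * ∑ k, Z' s a k * x k)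
    (bound := fun x => ∑ a : ι, A₁ * ∑ k, B * |x k|) (x₀ := t) (s := Set.univ) univ_mem
    (Eventually.of_forall fun s => (hFm.comp (hlin s)).aestronglyMeasurable)
    (Integrable.of_bound (hFm.comp (hlin t)).aestronglyMeasurable A₀ (ae_of_all _ fun x => hA₀ _))
    (Measurable.aestronglyMeasurable (Finset.measurable_sum _ fun a _ =>
      ((hFm₁ a).comp (hlin t)).mul (by fun_prop)))
    (ae_of_all _ fun x s _ => ?_)
    (integrable_finsetSum _ fun a _ => (integrable_finsetSum _ fun k _ =>
      (integrable_eval_stdPi k).abs.const_mul _).const_mul _)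
    (ae_of_all _ fun x s _ => hF₁ _ _ s (hcurve x s))).2
  · refine hmain.congr_deriv ?_
    have hint : ∀ a k, Integrable
        (fun x : κ → ℝ => F₁ a (fun a => ∑ k, Z t a k * x k) * (Z' t a k * x k)) (stdPi κ) :=
      fun a k => ((integrable_eval_stdPi k).const_mul _).bdd_mul
        ((hFm₁ a).comp (hlin t)).aestronglyMeasurable (ae_of_all _ fun x => hA₁ a _)
    simp_rw [Finset.mul_sum]
    rw [integral_finsetSum _ fun a _ => integrable_finsetSum _ fun k _ => hint a k]
    refine Finset.sum_congr rfl fun a _ => ?_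
    rw [integral_finsetSum _ fun k _ => hint a k]
    -- The derivative of the expectation is linear in the Gaussian coordinates; Stein trades each
    -- coordinate for a second derivative of F, leaving only the products of `Z'` with `Z`.
    have hstein : ∀ k, ∫ x, x k * F₁ a (fun a => ∑ k, Z t a k * x k) ∂(stdPi κ) =
        ∫ x, ∑ b, F₂ a b (fun a => ∑ k, Z t a k * x k) * Z t b k ∂(stdPi κ) := fun k => by
      refine integral_eval_mul_stdPi k (A := A₁) (A' := ∑ b, A₂ * |Z t b k|)
        ((hFm₁ a).comp (hlin t))
        (Finset.measurable_sum _ fun b _ => ((hFm₂ a b).comp (hlin t)).mul_const _)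
        (fun x => ?_) (fun x => hA₁ a _) fun x => ?_
      · have hc : ∀ b, HasDerivAt (fun s => ∑ l, Z t b l * Function.update x k s l)
            (Z t b k) (x k) := fun b => by
          have : HasDerivAt (fun s => ∑ l, Z t b l * Function.update x k s l)
              (∑ l, Z t b l * (Pi.single k (1 : ℝ) : κ → ℝ) l) (x k) :=
            HasDerivAt.fun_sum fun l _ =>
              ((hasDerivAt_pi.1 (hasDerivAt_update x k (x k))) l).const_mul _
          simpa [Pi.single_apply] using this
        have := hF₂ a _ _ _ hc
        simpa using this
      · refine (Finset.abs_sum_le_sum_abs _ _).trans (Finset.sum_le_sum fun b _ => ?_)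
        rw [abs_mul]
        gcongr
        exact hA₂ a b _
    calc ∑ k, ∫ x, F₁ a (fun a => ∑ k, Z t a k * x k) * (Z' t a k * x k) ∂(stdPi κ)
        = ∑ k, Z' t a k * ∑ b, Z t b k *
            ∫ x, F₂ a b (fun a => ∑ k, Z t a k * x k) ∂(stdPi κ) := by
          refine Finset.sum_congr rfl fun k _ => ?_
          rw [show (fun x : κ → ℝ => F₁ a (fun a => ∑ k, Z t a k * x k) * (Z' t a k * x k)) =
            fun x => Z' t a k * (x k * F₁ a (fun a => ∑ k, Z t a k * x k)) from
              funext fun x => by ring, integral_const_mul, hstein, integral_finsetSum]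
          · simp_rw [integral_mul_const, mul_comm]
          · exact fun b _ => (Integrable.of_bound ((hFm₂ a b).comp (hlin t)).aestronglyMeasurable
              A₂ (ae_of_all _ fun x => hA₂ a b _)).mul_const _
      _ = _ := by
          simp_rw [Finset.mul_sum, Finset.sum_mul]
          rw [Finset.sum_comm]
          simp_rw [mul_assoc]
  · refine (Finset.abs_sum_le_sum_abs _ _).trans (Finset.sum_le_sum fun a _ => ?_)
    rw [abs_mul]
    refine mul_le_mul (hA₁ a _) ((Finset.abs_sum_le_sum_abs _ _).trans
      (Finset.sum_le_sum fun k _ => ?_)) (abs_nonneg _) ((abs_nonneg _).trans (hA₁ a 0))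
    rw [abs_mul]
    gcongr
    exact hB s a k

/-! ### Smooth surrogates for the event that every row has a large entry. -/

section SmoothGordon

variable {I J : Type*} [Fintype J]

/-- A smooth approximation of the indicator function of `[c / N, ∞)`. -/
def softStep (N c z : ℝ) : ℝ := Real.sigmoid (N * z - c)

theorem softStep_nonneg (N c z : ℝ) : 0 ≤ softStep N c z := Real.sigmoid_nonneg _

theorem softStep_le_one (N c z : ℝ) : softStep N c z ≤ 1 := Real.sigmoid_le_one _

theorem measurable_softStep (N c : ℝ) : Measurable (softStep N c) :=
  (continuous_sigmoid.comp (by fun_prop)).measurable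

theorem hasDerivAt_softStep (N c : ℝ) {z : ℝ → ℝ} {z' t : ℝ} (hz : HasDerivAt z z' t) :
    HasDerivAt (fun s => softStep N c (z s))
      (N * softStep N c (z t) * (1 - softStep N c (z t)) * z') t := by
  have := (Real.hasDerivAt_sigmoid (N * z t - c)).comp t ((hz.const_mul N).sub_const c)
  refine this.congr_deriv ?_
  simp only [softStep]
  ring

/-- A smooth approximation of the indicator function of `{z | ∀ j, z (i, j) < c / N}`. -/
def softNone (N c : ℝ) (i : I) (z : I × J → ℝ) : ℝ := ∏ j, (1 - softStep N c (z (i, j)))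

theorem softNone_nonneg (N c : ℝ) (i : I) (z : I × J → ℝ) : 0 ≤ softNone N c i z :=
  Finset.prod_nonneg fun _ _ => sub_nonneg.2 (softStep_le_one _ _ _)

theorem softNone_le_one (N c : ℝ) (i : I) (z : I × J → ℝ) : softNone N c i z ≤ 1 :=
  Finset.prod_le_one (fun _ _ => sub_nonneg.2 (softStep_le_one _ _ _))
    fun _ _ => sub_le_self _ (softStep_nonneg _ _ _)

theorem measurable_softNone (N c : ℝ) (i : I) :
    Measurable (softNone N c i : (I × J → ℝ) → ℝ) :=
  Finset.measurable_prod _ fun _ _ =>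
    measurable_const.sub ((measurable_softStep N c).comp (measurable_pi_apply _))

theorem hasDerivAt_softNone (N c : ℝ) (i : I) {z : ℝ → I × J → ℝ} {z' : I × J → ℝ} {t : ℝ}
    (hz : ∀ a, HasDerivAt (fun s => z s a) (z' a) t) :
    HasDerivAt (fun s => softNone N c i (z s))
      (-∑ j, N * softStep N c (z t (i, j)) * softNone N c i (z t) * z' (i, j)) t := by
  classical
  have := HasDerivAt.fun_finsetProd (u := (Finset.univ : Finset J)) (x := t)
    (f := fun j s => 1 - softStep N c (z s (i, j)))
    fun j _ => (hasDerivAt_softStep N c (hz (i, j))).const_sub 1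
  refine this.congr_deriv ?_
  rw [← Finset.sum_neg_distrib]
  refine Finset.sum_congr rfl fun j hj => ?_
  simp only [softNone, smul_eq_mul]
  rw [← Finset.prod_erase_mul _ _ hj]
  ring

/-- A smooth approximation of the indicator function of `{z | ∀ i ∈ s, ∃ j, c / N ≤ z (i, j)}`. -/
def softAll (N c : ℝ) (s : Finset I) (z : I × J → ℝ) : ℝ := ∏ i ∈ s, (1 - softNone N c i z)

theorem softAll_nonneg (N c : ℝ) (s : Finset I) (z : I × J → ℝ) : 0 ≤ softAll N c s z :=
  Finset.prod_nonneg fun _ _ => sub_nonneg.2 (softNone_le_one _ _ _ _)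

theorem softAll_le_one (N c : ℝ) (s : Finset I) (z : I × J → ℝ) : softAll N c s z ≤ 1 :=
  Finset.prod_le_one (fun _ _ => sub_nonneg.2 (softNone_le_one _ _ _ _))
    fun _ _ => sub_le_self _ (softNone_nonneg _ _ _ _)

theorem measurable_softAll (N c : ℝ) (s : Finset I) :
    Measurable (softAll N c s : (I × J → ℝ) → ℝ) :=
  Finset.measurable_prod _ fun _ _ => measurable_const.sub (measurable_softNone N c _)

theorem abs_softStep_le_one (N c z : ℝ) : |softStep N c z| ≤ 1 :=
  abs_le.2 ⟨by linarith [softStep_nonneg N c z], softStep_le_one _ _ _⟩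

theorem abs_softNone_le_one (N c : ℝ) (i : I) (z : I × J → ℝ) : |softNone N c i z| ≤ 1 :=
  abs_le.2 ⟨by linarith [softNone_nonneg N c i z], softNone_le_one _ _ _ _⟩

theorem abs_softAll_le_one (N c : ℝ) (s : Finset I) (z : I × J → ℝ) : |softAll N c s z| ≤ 1 :=
  abs_le.2 ⟨by linarith [softAll_nonneg N c s z], softAll_le_one _ _ _ _⟩

variable [DecidableEq I]

theorem hasDerivAt_softAll (N c : ℝ) (u : Finset I) {z : ℝ → I × J → ℝ} {z' : I × J → ℝ} {t : ℝ}
    (hz : ∀ a, HasDerivAt (fun s => z s a) (z' a) t) :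
    HasDerivAt (fun s => softAll N c u (z s))
      (∑ i ∈ u, ∑ j, softAll N c (u.erase i) (z t) *
        (N * softStep N c (z t (i, j)) * softNone N c i (z t)) * z' (i, j)) t := by
  have := HasDerivAt.fun_finsetProd (u := u) (x := t)
    (f := fun i s => 1 - softNone N c i (z s))
    fun i _ => (hasDerivAt_softNone N c i hz).const_sub 1
  refine this.congr_deriv (Finset.sum_congr rfl fun i _ => ?_)
  simp only [softAll, smul_eq_mul, neg_neg, Finset.mul_sum]
  exact Finset.sum_congr rfl fun j _ => by ring

variable [Fintype I]

/-- The partial derivatives of `softAll N c univ`. -/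
def softAll₁ (N c : ℝ) (a : I × J) (z : I × J → ℝ) : ℝ :=
  softAll N c (Finset.univ.erase a.1) z * (N * softStep N c (z a) * softNone N c a.1 z)

open Classical in
/-- The second partial derivatives of `softAll N c univ`. -/
def softAll₂ (N c : ℝ) (a b : I × J) (z : I × J → ℝ) : ℝ :=
  if b.1 = a.1 then
    softAll N c (Finset.univ.erase a.1) z *
      (N * ((if b = a then N * softStep N c (z a) * (1 - softStep N c (z a)) else 0) -
        softStep N c (z a) * (N * softStep N c (z b))) * softNone N c a.1 z)
  else softAll N c ((Finset.univ.erase a.1).erase b.1) z *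
    (N * softStep N c (z b) * softNone N c b.1 z) * (N * softStep N c (z a) * softNone N c a.1 z)

theorem measurable_softAll₁ (N c : ℝ) (a : I × J) : Measurable (softAll₁ N c a) := by
  have h1 := measurable_softAll (J := J) N c (Finset.univ.erase a.1)
  have h2 := measurable_softNone (J := J) N c a.1
  have h3 := (measurable_softStep N c).comp (measurable_pi_apply (X := fun _ : I × J => ℝ) a)
  exact h1.mul ((h3.const_mul N).mul h2)

theorem measurable_softAll₂ (N c : ℝ) (a b : I × J) : Measurable (softAll₂ N c a b) := by
  have h1 := fun u => measurable_softAll (J := J) N c (u : Finset I)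
  have h2 := fun i => measurable_softNone (J := J) N c (i : I)
  have h3 := fun a => (measurable_softStep N c).comp
    (measurable_pi_apply (X := fun _ : I × J => ℝ) a)
  simp only [Function.comp_def] at h3
  unfold softAll₂
  split_ifs
  · exact (h1 _).mul (((((h3 a).const_mul N).mul (measurable_const.sub (h3 a))).sub
      ((h3 a).mul ((h3 b).const_mul N))).const_mul N |>.mul (h2 _))
  · exact (h1 _).mul ((measurable_const.sub
      ((h3 a).mul ((h3 b).const_mul N))).const_mul N |>.mul (h2 _))
  · exact ((h1 _).mul (((h3 b).const_mul N).mul (h2 _))).mul (((h3 a).const_mul N).mul (h2 _))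

/-- Entries of distinct rows enter distinct factors of the product, each factor monotone in its
entries in the same direction (that of the sign of `N`). `N` therefore occurs only as a square. This
sign drives Gordon's inequality; entries of one row have mixed derivatives of no fixed sign. -/
theorem softAll₂_nonneg (N c : ℝ) (a b : I × J) (hab : b.1 ≠ a.1) (z : I × J → ℝ) :
    0 ≤ softAll₂ N c a b z := by
  rw [softAll₂, if_neg hab]
  have h0 := softAll_nonneg N c ((Finset.univ.erase a.1).erase b.1) z
  have h1 := softStep_nonneg N c (z a)
  have h2 := softStep_nonneg N c (z b)
  have h3 := softNone_nonneg N c a.1 z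
  have h4 := softNone_nonneg N c b.1 z
  rw [show softAll N c ((Finset.univ.erase a.1).erase b.1) z *
    (N * softStep N c (z b) * softNone N c b.1 z) * (N * softStep N c (z a) * softNone N c a.1 z) =
    (N * N) * (softAll N c ((Finset.univ.erase a.1).erase b.1) z *
    (softStep N c (z b) * softNone N c b.1 z) * (softStep N c (z a) * softNone N c a.1 z)) by ring]
  have := mul_self_nonneg N
  positivity

theorem abs_softAll₁_le (N c : ℝ) (a : I × J) (z : I × J → ℝ) : |softAll₁ N c a z| ≤ |N| := by
  simp only [softAll₁, abs_mul]
  have h1 := abs_softAll_le_one N c (Finset.univ.erase a.1) z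
  have h2 := abs_softStep_le_one N c (z a)
  have h3 := abs_softNone_le_one N c a.1 z
  calc _ ≤ 1 * (|N| * 1 * 1) := by gcongr
    _ = |N| := by ring

theorem abs_softAll₂_le (N c : ℝ) (a b : I × J) (z : I × J → ℝ) :
    |softAll₂ N c a b z| ≤ 2 * (|N| * |N|) := by
  have h1 := fun u => abs_softAll_le_one N c u z
  have h2 := fun a => abs_softStep_le_one N c (z a)
  have h3 := fun i => abs_softNone_le_one N c i z
  unfold softAll₂
  split_ifs
  · simp only [abs_mul]
    have h4 : |N * softStep N c (z a) * (1 - softStep N c (z a)) -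
        softStep N c (z a) * (N * softStep N c (z b))| ≤ 2 * |N| := by
      refine (abs_sub _ _).trans ?_
      simp only [abs_mul]
      have h5 : |1 - softStep N c (z a)| ≤ 1 :=
        abs_le.2 ⟨by linarith [softStep_le_one N c (z a)], by linarith [softStep_nonneg N c (z a)]⟩
      calc _ ≤ |N| * 1 * 1 + 1 * (|N| * 1) := by gcongr <;> apply h2
        _ = 2 * |N| := by ring
    calc _ ≤ 1 * (|N| * (2 * |N|) * 1) := by
          gcongr
          · apply h1
          · apply h3
      _ = _ := by ring
  · simp only [abs_mul]
    have h4 : |0 - softStep N c (z a) * (N * softStep N c (z b))| ≤ 2 * |N| := by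
      rw [zero_sub, abs_neg]
      simp only [abs_mul]
      calc _ ≤ 1 * (|N| * 1) := by gcongr <;> apply h2
        _ ≤ 2 * |N| := by linarith [abs_nonneg N]
    calc _ ≤ 1 * (|N| * (2 * |N|) * 1) := by
          gcongr
          · apply h1
          · apply h3
      _ = _ := by ring
  · simp only [abs_mul]
    calc _ ≤ 1 * (|N| * 1 * 1) * (|N| * 1 * 1) := by
          gcongr
          · apply h1
          · apply h2
          · apply h3
          · apply h2
          · apply h3
      _ ≤ _ := by nlinarith [abs_nonneg N]

theorem hasDerivAt_softAll_univ (N c : ℝ) {z : ℝ → I × J → ℝ} {z' : I × J → ℝ} {t : ℝ}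
    (hz : ∀ a, HasDerivAt (fun s => z s a) (z' a) t) :
    HasDerivAt (fun s => softAll N c Finset.univ (z s)) (∑ a, softAll₁ N c a (z t) * z' a) t := by
  refine (hasDerivAt_softAll N c Finset.univ hz).congr_deriv ?_
  rw [Fintype.sum_prod_type]
  rfl

/-- Entries of other rows act only on the product over the remaining rows. Entries of the row of `a`
act on its `softNone` factor, and `a` itself also on its own step, whence the case distinction in
`softAll₂`. -/
theorem hasDerivAt_softAll₁ (N c : ℝ) (a : I × J) {z : ℝ → I × J → ℝ} {z' : I × J → ℝ} {t : ℝ}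
    (hz : ∀ a, HasDerivAt (fun s => z s a) (z' a) t) :
    HasDerivAt (fun s => softAll₁ N c a (z s)) (∑ b, softAll₂ N c a b (z t) * z' b) t := by
  classical
  have := (hasDerivAt_softAll N c (Finset.univ.erase a.1) hz).mul
    (((hasDerivAt_softStep N c (hz a)).const_mul N).mul (hasDerivAt_softNone N c a.1 hz))
  refine this.congr_deriv ?_
  rw [Fintype.sum_prod_type, ← Finset.sum_erase_add _ _ (Finset.mem_univ a.1)]
  congr 1
  · rw [Finset.sum_mul]
    refine Finset.sum_congr rfl fun i hi => ?_
    rw [Finset.sum_mul]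
    refine Finset.sum_congr rfl fun j _ => ?_
    simp only [softAll₂, if_neg (Finset.ne_of_mem_erase hi), Pi.mul_apply]
    ring
  · obtain ⟨i, j⟩ := a
    simp only [softAll₂, if_true, Prod.mk.injEq, true_and]
    simp_rw [sub_eq_add_neg, mul_add, add_mul, mul_add, add_mul, Finset.sum_add_distrib]
    congr 1
    · rw [Finset.sum_eq_single j]
      · simp only [if_true]; ring
      · intro l _ hl
        simp [hl]
      · simp
    · rw [← Finset.sum_neg_distrib, Finset.mul_sum, Finset.mul_sum]
      exact Finset.sum_congr rfl fun l _ => by ring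

end SmoothGordon

/-! ### Gordon's comparison inequality for finite Gaussian families. -/

theorem measurePreserving_comp_inl (κ₁ κ₂ : Type*) [Fintype κ₁] [Fintype κ₂] :
    MeasurePreserving (fun (x : κ₁ ⊕ κ₂ → ℝ) k => x (Sum.inl k)) (stdPi (κ₁ ⊕ κ₂)) (stdPi κ₁) :=
  (measurePreserving_fst (μ := stdPi κ₁) (ν := stdPi κ₂)).comp
    (measurePreserving_sumPiEquivProdPi fun _ : κ₁ ⊕ κ₂ => gaussianReal 0 1)

theorem measurePreserving_comp_inr (κ₁ κ₂ : Type*) [Fintype κ₁] [Fintype κ₂] :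
    MeasurePreserving (fun (x : κ₁ ⊕ κ₂ → ℝ) k => x (Sum.inr k)) (stdPi (κ₁ ⊕ κ₂)) (stdPi κ₂) :=
  (measurePreserving_snd (μ := stdPi κ₁) (ν := stdPi κ₂)).comp
    (measurePreserving_sumPiEquivProdPi fun _ : κ₁ ⊕ κ₂ => gaussianReal 0 1)

section Gordon

variable {I J κ₁ κ₂ : Type*} [Fintype I] [Fintype J] [Fintype κ₁] [Fintype κ₂]
  {A : I × J → κ₁ → ℝ} {B : I × J → κ₂ → ℝ}

theorem measurable_softAll_linear {κ : Type*} [Fintype κ] (N c : ℝ) (M : I × J → κ → ℝ) :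
    Measurable fun x : κ → ℝ => softAll N c Finset.univ fun a => ∑ k, M a k * x k :=
  (measurable_softAll N c Finset.univ).comp
    (by fun_prop : Measurable fun (x : κ → ℝ) (a : I × J) => ∑ k, M a k * x k)

/-- Gordon's comparison inequality for the smooth functionals `softAll`. -/
theorem integral_softAll_le
    (heq : ∀ a b, a.1 = b.1 → ∑ k, A a k * A b k = ∑ k, B a k * B b k)
    (hle : ∀ a b, a.1 ≠ b.1 → ∑ k, B a k * B b k ≤ ∑ k, A a k * A b k) (N c : ℝ) :
    ∫ y, softAll N c Finset.univ (fun a => ∑ k, B a k * y k) ∂(stdPi κ₂) ≤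
      ∫ x, softAll N c Finset.univ (fun a => ∑ k, A a k * x k) ∂(stdPi κ₁) := by
  classical
  -- Rotation from the process of `A` at time 0 to an independent copy of the process of `B` at time
  -- π/2; the independence is encoded by the disjoint sum of index types.
  let Z : ℝ → I × J → κ₁ ⊕ κ₂ → ℝ := fun t a =>
    Sum.elim (fun k => Real.cos t * A a k) fun k => Real.sin t * B a k
  let Z' : ℝ → I × J → κ₁ ⊕ κ₂ → ℝ := fun t a =>
    Sum.elim (fun k => -Real.sin t * A a k) fun k => Real.cos t * B a k
  have hZ : ∀ t a k, HasDerivAt (fun s => Z s a k) (Z' t a k) t := by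
    rintro t a (k | k)
    · exact (Real.hasDerivAt_cos t).mul_const _
    · exact (Real.hasDerivAt_sin t).mul_const _
  have hB : ∀ t a k, |Z' t a k| ≤
      ∑ a, ((∑ k, |A a k|) + ∑ k, |B a k|) := by
    intro t a k
    have h1 : |Z' t a k| ≤ (∑ k, |A a k|) + ∑ k, |B a k| := by
      have hA0 : 0 ≤ ∑ k, |A a k| := Finset.sum_nonneg fun _ _ => abs_nonneg _
      have hB0 : 0 ≤ ∑ k, |B a k| := Finset.sum_nonneg fun _ _ => abs_nonneg _
      rcases k with k | k
      · have h2 : |A a k| ≤ ∑ k, |A a k| :=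
          Finset.single_le_sum (f := fun k => |A a k|) (fun _ _ => abs_nonneg _) (Finset.mem_univ k)
        simp only [Z', Sum.elim_inl, abs_mul, abs_neg]
        nlinarith [Real.abs_sin_le_one t, abs_nonneg (A a k)]
      · have h2 : |B a k| ≤ ∑ k, |B a k| :=
          Finset.single_le_sum (f := fun k => |B a k|) (fun _ _ => abs_nonneg _) (Finset.mem_univ k)
        simp only [Z', Sum.elim_inr, abs_mul]
        nlinarith [Real.abs_cos_le_one t, abs_nonneg (B a k)]
    exact h1.trans (Finset.single_le_sum (f := fun a => (∑ k, |A a k|) + ∑ k, |B a k|)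
      (fun _ _ => by positivity) (Finset.mem_univ a))
  have hder := hasDerivAt_integral_stdPi (measurable_softAll N c (Finset.univ : Finset I))
    (measurable_softAll₁ N c) (measurable_softAll₂ (J := J) N c)
    (fun _ _ _ => hasDerivAt_softAll_univ N c) (fun a _ _ _ => hasDerivAt_softAll₁ N c a)
    (abs_softAll_le_one N c _) (abs_softAll₁_le N c) (abs_softAll₂_le N c) hZ hB
  have hanti : AntitoneOn (fun s => ∫ x, softAll N c Finset.univ
      (fun a => ∑ k, Z s a k * x k) ∂(stdPi (κ₁ ⊕ κ₂))) (Set.Icc 0 (Real.pi / 2)) := by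
    refine antitoneOn_of_deriv_nonpos (convex_Icc _ _)
      (fun t _ => (hder t).continuousAt.continuousWithinAt)
      (fun t _ => (hder t).differentiableAt.differentiableWithinAt) fun t ht => ?_
    rw [interior_Icc] at ht
    rw [(hder t).deriv]
    refine Finset.sum_nonpos fun a _ => Finset.sum_nonpos fun b _ => ?_
    have hsin := (Real.sin_pos_of_pos_of_lt_pi ht.1 (by linarith [ht.2, Real.pi_pos])).le
    have hcos := (Real.cos_pos_of_mem_Ioo ⟨by linarith [ht.1, Real.pi_pos], ht.2⟩).le
    have hcov : ∑ k, Z' t a k * Z t b k = -(Real.sin t * Real.cos t *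
        (∑ k, A a k * A b k - ∑ k, B a k * B b k)) := by
      simp only [Z, Z', Fintype.sum_sum_type, Sum.elim_inl, Sum.elim_inr, mul_sub, neg_sub,
        Finset.mul_sum]
      rw [sub_eq_neg_add, ← Finset.sum_neg_distrib]
      congr 1 <;> exact Finset.sum_congr rfl fun k _ => by ring
    rw [hcov, neg_mul, neg_nonpos]
    -- Within a row the covariances agree and the term vanishes, so the unsigned second derivatives
    -- do no harm. Across rows both factors have a sign.
    by_cases hab : a.1 = b.1
    · simp [heq a b hab]
    · exact mul_nonneg (mul_nonneg (mul_nonneg hsin hcos) (sub_nonneg.2 (hle a b hab)))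
        (integral_nonneg fun x => softAll₂_nonneg N c a b (Ne.symm hab) _)
  have h := hanti ⟨le_rfl, by positivity⟩ ⟨by positivity, le_rfl⟩
    (by positivity : (0 : ℝ) ≤ Real.pi / 2)
  rw [← (measurePreserving_comp_inl κ₁ κ₂).map_eq, ← (measurePreserving_comp_inr κ₁ κ₂).map_eq,
    integral_map (measurePreserving_comp_inl κ₁ κ₂).aemeasurable (measurable_softAll_linear N c A).aestronglyMeasurable,
    integral_map (measurePreserving_comp_inr κ₁ κ₂).aemeasurable
      (measurable_softAll_linear N c B).aestronglyMeasurable]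
  simpa [Z, Fintype.sum_sum_type] using h

/-- The shift √n tends to infinity but is negligible against n, so the boundary point z = u also
receives the limit 1. The closed event is reached exactly, without excluding atoms of the Gaussian
family. -/
theorem tendsto_softStep (u z : ℝ) :
    Tendsto (fun n : ℕ => softStep n (n * u - √n) z) atTop (𝓝 (if u ≤ z then 1 else 0)) := by
  have hsq : Tendsto (fun n : ℕ => √(n : ℝ)) atTop atTop :=
    Real.tendsto_sqrt_atTop.comp tendsto_natCast_atTop_atTop
  unfold softStep
  split_ifs with h
  · refine Real.tendsto_sigmoid_atTop.comp (tendsto_atTop_mono (fun n => ?_) hsq)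
    nlinarith [(Nat.cast_nonneg n : (0 : ℝ) ≤ n)]
  · refine Real.tendsto_sigmoid_atBot.comp ?_
    have h1 : Tendsto (fun n : ℕ => √(n : ℝ) * (1 - √(n : ℝ) * (u - z))) atTop atBot := by
      refine hsq.atTop_mul_atBot₀ ?_
      have := hsq.atTop_mul_const (sub_pos.2 (not_le.1 h))
      exact tendsto_atBot_add_const_left _ _ (tendsto_neg_atTop_atBot.comp this)
    refine h1.congr fun n => ?_
    have := Real.mul_self_sqrt (Nat.cast_nonneg n : (0 : ℝ) ≤ n)
    linear_combination -(u - z) * this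

theorem tendsto_softAll (u : ℝ) (z : I × J → ℝ) :
    Tendsto (fun n : ℕ => softAll n (n * u - √n) Finset.univ z) atTop
      (𝓝 ({z | ∀ i, ∃ j, u ≤ z (i, j)}.indicator 1 z)) := by
  classical
  have h := tendsto_finsetProd (Finset.univ : Finset I) fun i _ =>
    (tendsto_finsetProd (Finset.univ : Finset J) fun j _ =>
      (tendsto_softStep u (z (i, j))).const_sub 1).const_sub 1
  have hlim : ∏ i, (1 - ∏ j, (1 - if u ≤ z (i, j) then (1 : ℝ) else 0)) =
      {z | ∀ i, ∃ j, u ≤ z (i, j)}.indicator 1 z := by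
    by_cases hz : ∀ i, ∃ j, u ≤ z (i, j)
    · rw [Set.indicator_of_mem (by exact hz), Pi.one_apply]
      refine Finset.prod_eq_one fun i _ => ?_
      obtain ⟨j, hj⟩ := hz i
      rw [Finset.prod_eq_zero (Finset.mem_univ j) (by simp [hj]), sub_zero]
    · rw [Set.indicator_of_notMem (by exact hz)]
      push Not at hz
      obtain ⟨i, hi⟩ := hz
      refine Finset.prod_eq_zero (Finset.mem_univ i) ?_
      rw [Finset.prod_eq_one fun j _ => by simp [hi j], sub_self]
  rw [hlim] at h
  exact h

theorem tendsto_integral_softAll {κ : Type*} [Fintype κ] (u : ℝ) (M : I × J → κ → ℝ) :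
    Tendsto (fun n : ℕ =>
      ∫ x, softAll n (n * u - √n) Finset.univ (fun a => ∑ k, M a k * x k) ∂(stdPi κ)) atTop
      (𝓝 ((stdPi κ).real {x | ∀ i, ∃ j, u ≤ ∑ k, M (i, j) k * x k})) := by
  have hm : MeasurableSet {x : κ → ℝ | ∀ i, ∃ j, u ≤ ∑ k, M (i, j) k * x k} := by
    simp only [Set.ofPred_forall, Set.ofPred_exists]
    exact MeasurableSet.iInter fun i => MeasurableSet.iUnion fun j =>
      measurableSet_le measurable_const (by fun_prop)
  rw [← integral_indicator_one hm]
  exact tendsto_integral_of_dominated_convergence (fun _ => 1)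
    (fun n => (measurable_softAll_linear _ _ M).aestronglyMeasurable)
    (integrable_const _) (fun n => ae_of_all _ fun x => abs_softAll_le_one _ _ _ _)
    (ae_of_all _ fun x => tendsto_softAll u _)

/-- Gordon's comparison inequality for the distribution functions of `min_i max_j`. -/
theorem measureReal_forall_exists_le
    (heq : ∀ a b, a.1 = b.1 → ∑ k, A a k * A b k = ∑ k, B a k * B b k)
    (hle : ∀ a b, a.1 ≠ b.1 → ∑ k, B a k * B b k ≤ ∑ k, A a k * A b k) (u : ℝ) :
    (stdPi κ₂).real {y | ∀ i, ∃ j, u ≤ ∑ k, B (i, j) k * y k} ≤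
      (stdPi κ₁).real {x | ∀ i, ∃ j, u ≤ ∑ k, A (i, j) k * x k} :=
  le_of_tendsto_of_tendsto' (tendsto_integral_softAll u B) (tendsto_integral_softAll u A)
    fun _ => integral_softAll_le heq hle _ _

end Gordon

/-! ### Gaussian concentration through a covariance inequality. -/

section Concentration

variable {ι : Type*} [Fintype ι]

theorem hasDerivAt_comp_of_hasGradientAt {E : Type*} [NormedAddCommGroup E]
    [InnerProductSpace ℝ E] [CompleteSpace E] {f : E → ℝ} {g v : E} {c : ℝ → E} {t : ℝ}
    (hf : HasGradientAt f g (c t)) (hc : HasDerivAt c v t) :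
    HasDerivAt (fun s => f (c s)) ⟪g, v⟫ t :=
  (hf.hasFDerivAt.comp_hasDerivAt t hc).congr_deriv (by simp)

/-- Stein's identity for a standard Gaussian vector. -/
theorem integral_inner_mul_stdGaussian {f : EuclideanSpace ℝ ι → ℝ}
    {f' : EuclideanSpace ℝ ι → EuclideanSpace ℝ ι} {A A' : ℝ}
    (hf : ∀ x, HasGradientAt f (f' x) x) (hf' : Continuous f') (hA : ∀ x, |f x| ≤ A)
    (hA' : ∀ x, ‖f' x‖ ≤ A') (v : EuclideanSpace ℝ ι) :
    ∫ x, f x * ⟪v, x⟫ ∂(stdGaussian (EuclideanSpace ℝ ι)) =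
      ∫ x, ⟪v, f' x⟫ ∂(stdGaussian (EuclideanSpace ℝ ι)) := by
  classical
  have hfc : Continuous f := continuous_iff_continuousAt.2 fun x =>
    (hf x).differentiableAt.continuousAt
  have hLp : Measurable (WithLp.toLp 2 : (ι → ℝ) → EuclideanSpace ℝ ι) := by fun_prop
  rw [← map_pi_eq_stdGaussian, integral_map hLp.aemeasurable (by fun_prop),
    integral_map hLp.aemeasurable (by fun_prop)]
  have hstein : ∀ k, ∫ x, x k * f (WithLp.toLp 2 x) ∂(stdPi ι) =
      ∫ x, f' (WithLp.toLp 2 x) k ∂(stdPi ι) := fun k => by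
    refine integral_eval_mul_stdPi k (A := A) (A' := A') (hfc.measurable.comp hLp)
      (Measurable.comp (g := fun y : EuclideanSpace ℝ ι => f' y k) (by fun_prop) hLp)
      (fun x => ?_) (fun x => hA _) fun x => (PiLp.norm_apply_le _ k).trans (hA' _)
    have hc : HasDerivAt (fun s => (WithLp.toLp 2 (Function.update x k s) : EuclideanSpace ℝ ι))
        (EuclideanSpace.single k 1) (x k) := by
      have h1 : ∀ s, (WithLp.toLp 2 (Function.update x k s) : EuclideanSpace ℝ ι) =
          WithLp.toLp 2 x + (s - x k) • EuclideanSpace.single k (1 : ℝ) := fun s => by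
        ext i
        by_cases hi : i = k
        · subst hi; simp
        · simp [hi]
      simp_rw [h1]
      have := (((hasDerivAt_id (x k)).sub_const (x k)).smul_const
        (EuclideanSpace.single k (1 : ℝ))).const_add (WithLp.toLp 2 x)
      simpa using this
    have := hasDerivAt_comp_of_hasGradientAt (hf _) hc
    simpa [EuclideanSpace.inner_single_right] using this
  have hint : ∀ k, Integrable (fun x => x k * f (WithLp.toLp 2 x)) (stdPi ι) := fun k =>
    (integrable_eval_stdPi k).mul_bdd (hfc.measurable.comp hLp).aestronglyMeasurable
      (ae_of_all _ fun x => hA _)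
  have hint' : ∀ k, Integrable (fun x => f' (WithLp.toLp 2 x) k) (stdPi ι) := fun k =>
    Integrable.of_bound (Measurable.comp (g := fun y : EuclideanSpace ℝ ι => f' y k)
      (by fun_prop) hLp).aestronglyMeasurable A'
      (ae_of_all _ fun x => (PiLp.norm_apply_le _ k).trans (hA' _))
  calc ∫ x, f (WithLp.toLp 2 x) * ⟪v, WithLp.toLp 2 x⟫ ∂(stdPi ι)
      = ∫ x, ∑ k, v k * (x k * f (WithLp.toLp 2 x)) ∂(stdPi ι) := by
        refine integral_congr_ae (ae_of_all _ fun x => ?_)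
        simp only [PiLp.inner_apply, Finset.mul_sum]
        exact Finset.sum_congr rfl fun k _ => by simp; ring
    _ = ∑ k, v k * ∫ x, f' (WithLp.toLp 2 x) k ∂(stdPi ι) := by
        rw [integral_finsetSum _ fun k _ => (hint k).const_mul _]
        exact Finset.sum_congr rfl fun k _ => by rw [integral_const_mul, hstein]
    _ = ∫ x, ⟪v, f' (WithLp.toLp 2 x)⟫ ∂(stdPi ι) := by
        simp_rw [← integral_const_mul]
        rw [← integral_finsetSum _ fun k _ => (hint' k).const_mul _]
        refine integral_congr_ae (ae_of_all _ fun x => ?_)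
        simp only [PiLp.inner_apply]
        exact Finset.sum_congr rfl fun k _ => by simp; ring

theorem measurePreserving_rotation (θ : ℝ) :
    MeasurePreserving (ContinuousLinearMap.rotation θ :
        EuclideanSpace ℝ ι × EuclideanSpace ℝ ι →L[ℝ] _)
      ((stdGaussian (EuclideanSpace ℝ ι)).prod (stdGaussian (EuclideanSpace ℝ ι)))
      ((stdGaussian (EuclideanSpace ℝ ι)).prod (stdGaussian (EuclideanSpace ℝ ι))) :=
  ⟨by fun_prop, IsGaussian.map_rotation_eq_self (by simp) θ⟩

/-- A bound for the covariance of a `1`-Lipschitz function `f` and a function `h` of a standard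
Gaussian vector. -/
theorem integral_mul_sub_le {f h : EuclideanSpace ℝ ι → ℝ}
    {f' h' : EuclideanSpace ℝ ι → EuclideanSpace ℝ ι} {A B B' : ℝ}
    (hf : ∀ x, HasGradientAt f (f' x) x) (hf' : Continuous f') (hA : ∀ x, |f x| ≤ A)
    (hf1 : ∀ x, ‖f' x‖ ≤ 1)
    (hh : ∀ x, HasGradientAt h (h' x) x) (hh' : Continuous h') (hB : ∀ x, |h x| ≤ B)
    (hB' : ∀ x, ‖h' x‖ ≤ B') :
    ∫ x, f x * h x ∂(stdGaussian (EuclideanSpace ℝ ι)) -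
      (∫ x, f x ∂(stdGaussian (EuclideanSpace ℝ ι))) *
        ∫ x, h x ∂(stdGaussian (EuclideanSpace ℝ ι)) ≤
      ∫ x, ‖h' x‖ ∂(stdGaussian (EuclideanSpace ℝ ι)) := by
  set μ := stdGaussian (EuclideanSpace ℝ ι) with hμ
  have hfc : Continuous f := continuous_iff_continuousAt.2 fun x =>
    (hf x).differentiableAt.continuousAt
  have hhc : Continuous h := continuous_iff_continuousAt.2 fun x =>
    (hh x).differentiableAt.continuousAt
  have hA0 : 0 ≤ A := (abs_nonneg _).trans (hA 0)
  have hB0 : 0 ≤ B' := (norm_nonneg _).trans (hB' 0)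
  have hnorm : Integrable (fun x : EuclideanSpace ℝ ι => ‖x‖) μ :=
    (IsGaussian.integrable_id (μ := μ)).norm
  have hnorm2 : Integrable (fun p : EuclideanSpace ℝ ι × EuclideanSpace ℝ ι => ‖p.1‖ + ‖p.2‖)
      (μ.prod μ) := (hnorm.comp_fst μ).add (hnorm.comp_snd μ)
  -- The mean of `Φ` runs from 𝔼[fh] at angle 0 to 𝔼f · 𝔼h at π/2, so the covariance is controlled
  -- by its derivative.
  let Φ : ℝ → EuclideanSpace ℝ ι × EuclideanSpace ℝ ι → ℝ := fun θ p =>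
    f p.1 * h (Real.cos θ • p.1 + Real.sin θ • p.2)
  let Φ' : ℝ → EuclideanSpace ℝ ι × EuclideanSpace ℝ ι → ℝ := fun θ p =>
    f p.1 * ⟪h' (Real.cos θ • p.1 + Real.sin θ • p.2), -Real.sin θ • p.1 + Real.cos θ • p.2⟫
  have hder : ∀ θ, HasDerivAt (fun θ => ∫ p, Φ θ p ∂(μ.prod μ)) (∫ p, Φ' θ p ∂(μ.prod μ)) θ := by
    intro θ
    refine (hasDerivAt_integral_of_dominated_loc_of_deriv_le (μ := μ.prod μ)
      (F := Φ) (F' := Φ') (bound := fun p => A * (B' * (‖p.1‖ + ‖p.2‖))) (s := Set.univ)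
      univ_mem (Eventually.of_forall fun s => ?_) ?_ ?_ ?_ ((hnorm2.const_mul B').const_mul A)
      ?_).2
    · exact Continuous.aestronglyMeasurable (by fun_prop)
    · refine Integrable.of_bound (Continuous.aestronglyMeasurable (by fun_prop)) (A * B)
        (ae_of_all _ fun p => ?_)
      rw [Real.norm_eq_abs, abs_mul]
      exact mul_le_mul (hA _) (hB _) (abs_nonneg _) hA0
    · exact Continuous.aestronglyMeasurable (by fun_prop)
    · refine ae_of_all _ fun p s _ => ?_
      rw [Real.norm_eq_abs, abs_mul]
      refine mul_le_mul (hA _) ((abs_real_inner_le_norm _ _).trans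
        (mul_le_mul (hB' _) ?_ (norm_nonneg _) hB0)) (abs_nonneg _) hA0
      refine (norm_add_le _ _).trans (add_le_add ?_ ?_)
      · rw [norm_smul, norm_neg]
        exact mul_le_of_le_one_left (norm_nonneg _) (Real.abs_sin_le_one s)
      · rw [norm_smul]
        exact mul_le_of_le_one_left (norm_nonneg _) (Real.abs_cos_le_one s)
    · refine ae_of_all _ fun p s _ => ?_
      have hc : HasDerivAt (fun θ => Real.cos θ • p.1 + Real.sin θ • p.2)
          (-Real.sin s • p.1 + Real.cos s • p.2) s :=
        ((Real.hasDerivAt_cos s).smul_const _).add ((Real.hasDerivAt_sin s).smul_const _)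
      exact (hasDerivAt_comp_of_hasGradientAt (hh _) hc).const_mul _
  have hrot : ∀ θ, 0 ≤ Real.sin θ →
      -(Real.sin θ * ∫ x, ‖h' x‖ ∂μ) ≤ ∫ p, Φ' θ p ∂(μ.prod μ) := by
    intro θ hθ
    -- In rotated variables (U, V), which are again independent standard Gaussians, the derivative
    -- of the path is V and the argument of f is cos θ U - sin θ V. Stein in V, with U fixed, then
    -- produces the factor -sin θ and the gradient of f.
    let Ψ : EuclideanSpace ℝ ι × EuclideanSpace ℝ ι → ℝ := fun p =>
      f (Real.cos θ • p.1 - Real.sin θ • p.2) * ⟪h' p.1, p.2⟫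
    have hΨ : ∀ p, Φ' θ p = Ψ (ContinuousLinearMap.rotation θ p) := fun p => by
      simp only [Φ', Ψ, ContinuousLinearMap.rotation_apply]
      congr 2
      have hsc := Real.sin_sq_add_cos_sq θ
      calc p.1 = (Real.sin θ ^ 2 + Real.cos θ ^ 2) • p.1 := by rw [hsc, one_smul]
        _ = _ := by module
    have hΨi : Integrable Ψ (μ.prod μ) := by
      refine ((hnorm.comp_snd μ).const_mul (A * B')).mono'
        (Continuous.aestronglyMeasurable (by fun_prop)) (ae_of_all _ fun p => ?_)
      rw [Real.norm_eq_abs, abs_mul, mul_assoc]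
      exact mul_le_mul (hA _) ((abs_real_inner_le_norm _ _).trans
        (mul_le_mul_of_nonneg_right (hB' _) (norm_nonneg _))) (abs_nonneg _) hA0
    have hint : Integrable (fun x => ‖h' x‖) μ :=
      Integrable.of_bound hh'.norm.aestronglyMeasurable B'
        (ae_of_all _ fun x => by simpa using hB' x)
    simp_rw [hΨ]
    have hrp := measurePreserving_rotation (ι := ι) θ
    rw [← hμ] at hrp
    have hmap := integral_map (φ := (ContinuousLinearMap.rotation θ :
      EuclideanSpace ℝ ι × EuclideanSpace ℝ ι →L[ℝ] _)) hrp.aemeasurable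
      (f := Ψ) (by rw [hrp.map_eq]; exact hΨi.1)
    rw [← hmap, hrp.map_eq, integral_prod _ hΨi, ← integral_const_mul, ← integral_neg]
    refine integral_mono (hint.const_mul _).neg hΨi.integral_prod_left fun z => ?_
    have hgrad : ∀ w, HasGradientAt (fun w => f (Real.cos θ • z - Real.sin θ • w))
        (-Real.sin θ • f' (Real.cos θ • z - Real.sin θ • w)) w := fun w => by
      have h1 : HasFDerivAt (fun w : EuclideanSpace ℝ ι => Real.cos θ • z - Real.sin θ • w)
          (-(Real.sin θ • ContinuousLinearMap.id ℝ (EuclideanSpace ℝ ι))) w :=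
        ((hasFDerivAt_id w).const_smul (Real.sin θ)).const_sub _
      rw [hasGradientAt_iff_hasFDerivAt]
      refine ((hf _).hasFDerivAt.comp w h1).congr_fderiv ?_
      ext u
      simp
    have hst := integral_inner_mul_stdGaussian (A := A) (A' := Real.sin θ) hgrad (by fun_prop)
      (fun w => hA _) (fun w => by
        rw [norm_smul, norm_neg, Real.norm_eq_abs, abs_of_nonneg hθ]
        exact mul_le_of_le_one_right hθ (hf1 _)) (h' z)
    have hle : ∀ w, -(Real.sin θ * ‖h' z‖) ≤
        ⟪h' z, -Real.sin θ • f' (Real.cos θ • z - Real.sin θ • w)⟫ := fun w => by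
      rw [inner_smul_right, neg_mul, neg_le_neg_iff]
      refine mul_le_mul_of_nonneg_left ((real_inner_le_norm _ _).trans ?_) hθ
      exact mul_le_of_le_one_right (norm_nonneg _) (hf1 _)
    calc -(Real.sin θ * ‖h' z‖) = ∫ w, -(Real.sin θ * ‖h' z‖) ∂μ := by simp
      _ ≤ ∫ w, ⟪h' z, -Real.sin θ • f' (Real.cos θ • z - Real.sin θ • w)⟫ ∂μ := by
          refine integral_mono (integrable_const _) ?_ hle
          refine Integrable.of_bound (Continuous.aestronglyMeasurable (by fun_prop))
            (B' * Real.sin θ) (ae_of_all _ fun w => ?_)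
          refine (abs_real_inner_le_norm _ _).trans (mul_le_mul (hB' _) ?_ (norm_nonneg _) hB0)
          rw [norm_smul, norm_neg, Real.norm_eq_abs, abs_of_nonneg hθ]
          exact mul_le_of_le_one_right hθ (hf1 _)
      _ = _ := by rw [hμ, ← hst]
  have hmono : MonotoneOn (fun θ => ∫ p, Φ θ p ∂(μ.prod μ) - Real.cos θ * ∫ x, ‖h' x‖ ∂μ)
      (Set.Icc 0 (Real.pi / 2)) := by
    have hd : ∀ θ, HasDerivAt
        (fun θ => ∫ p, Φ θ p ∂(μ.prod μ) - Real.cos θ * ∫ x, ‖h' x‖ ∂μ)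
        (∫ p, Φ' θ p ∂(μ.prod μ) - -Real.sin θ * ∫ x, ‖h' x‖ ∂μ) θ := fun θ =>
      (hder θ).sub ((Real.hasDerivAt_cos θ).mul_const _)
    refine monotoneOn_of_deriv_nonneg (convex_Icc _ _)
      (fun t _ => (hd t).continuousAt.continuousWithinAt)
      (fun t _ => (hd t).differentiableAt.differentiableWithinAt) fun t ht => ?_
    rw [interior_Icc] at ht
    rw [(hd t).deriv]
    have := hrot t (Real.sin_pos_of_pos_of_lt_pi ht.1 (by linarith [ht.2, Real.pi_pos])).le
    linarith
  have hfin := hmono ⟨le_rfl, by positivity⟩ ⟨by positivity, le_rfl⟩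
    (by positivity : (0 : ℝ) ≤ Real.pi / 2)
  have h0 : ∫ p, Φ 0 p ∂(μ.prod μ) = ∫ x, f x * h x ∂μ := by
    have : Φ 0 = fun p => f p.1 * h p.1 := by
      funext p
      simp [Φ]
    rw [this, integral_fun_fst (fun x => f x * h x)]
    simp
  have h1 : ∫ p, Φ (Real.pi / 2) p ∂(μ.prod μ) = (∫ x, f x ∂μ) * ∫ x, h x ∂μ := by
    rw [← integral_prod_mul]
    simp [Φ]
  simp only [Real.cos_zero, Real.cos_pi_div_two, h0, h1] at hfin
  linarith

/-- Gaussian concentration for bounded smooth functions, `t ≥ 0`. -/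
theorem integral_exp_le_of_nonneg {f : EuclideanSpace ℝ ι → ℝ}
    {f' : EuclideanSpace ℝ ι → EuclideanSpace ℝ ι} {A : ℝ}
    (hf : ∀ x, HasGradientAt f (f' x) x) (hf' : Continuous f') (hA : ∀ x, |f x| ≤ A)
    (hf1 : ∀ x, ‖f' x‖ ≤ 1) {t : ℝ} (ht : 0 ≤ t) :
    ∫ x, Real.exp (t * f x) ∂(stdGaussian (EuclideanSpace ℝ ι)) ≤
      Real.exp (t * ∫ x, f x ∂(stdGaussian (EuclideanSpace ℝ ι)) + t ^ 2 / 2) := by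
  set μ := stdGaussian (EuclideanSpace ℝ ι) with hμ
  have hfc : Continuous f := continuous_iff_continuousAt.2 fun x =>
    (hf x).differentiableAt.continuousAt
  have hset : integrableExpSet f μ = Set.univ := Set.eq_univ_of_forall fun s =>
    integrable_exp_mul_of_mem_Icc (a := -A) (b := A) hfc.aemeasurable
      (ae_of_all _ fun x => abs_le.1 (hA x))
  have hder : ∀ s, HasDerivAt (mgf f μ) (∫ x, f x * Real.exp (s * f x) ∂μ) s := fun s =>
    hasDerivAt_mgf (by simp [hset])
  have hbound : ∀ s, 0 ≤ s → ∫ x, f x * Real.exp (s * f x) ∂μ ≤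
      ((∫ x, f x ∂μ) + s) * mgf f μ s := by
    intro s hs
    have hexp : ∀ x, Real.exp (s * f x) ≤ Real.exp (s * A) := fun x =>
      Real.exp_le_exp.2 (mul_le_mul_of_nonneg_left (abs_le.1 (hA x)).2 hs)
    have hnorm : ∀ x, ‖(s * Real.exp (s * f x)) • f' x‖ ≤ s * Real.exp (s * f x) := fun x => by
      rw [norm_smul, Real.norm_eq_abs, abs_of_nonneg (by positivity)]
      exact mul_le_of_le_one_right (by positivity) (hf1 x)
    -- With h = exp(sf) the gradient has norm at most s exp(sf), so the covariance bound becomes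
    -- M'(s) ≤ (𝔼f + s) M(s) for the moment generating function M; Grönwall's argument below
    -- integrates it.
    have hcov := integral_mul_sub_le (A := A) (B := Real.exp (s * A)) (B' := s * Real.exp (s * A))
      (h := fun x => Real.exp (s * f x)) (h' := fun x => (s * Real.exp (s * f x)) • f' x)
      hf hf' hA hf1 (fun x => by
        rw [hasGradientAt_iff_hasFDerivAt]
        refine ((hf x).hasFDerivAt.const_mul s).exp.congr_fderiv ?_
        ext u
        simp
        ring) (by fun_prop)
      (fun x => by rw [abs_of_pos (Real.exp_pos _)]; exact hexp x)
      (fun x => (hnorm x).trans (mul_le_mul_of_nonneg_left (hexp x) hs))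
    have hi : Integrable (fun x => Real.exp (s * f x)) μ := by
      have : s ∈ integrableExpSet f μ := by simp [hset]
      exact this
    have h2 : ∫ x, ‖(s * Real.exp (s * f x)) • f' x‖ ∂μ ≤ s * mgf f μ s := by
      rw [mgf, ← integral_const_mul]
      exact integral_mono_of_nonneg (ae_of_all _ fun _ => norm_nonneg _) (hi.const_mul s)
        (ae_of_all _ hnorm)
    have h3 : mgf f μ s = ∫ x, Real.exp (s * f x) ∂μ := rfl
    rw [← hμ, ← h3] at hcov
    linarith
  have hanti : AntitoneOn
      (fun s => mgf f μ s * Real.exp (-(s * (∫ x, f x ∂μ) + s ^ 2 / 2))) (Set.Ici 0) := by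
    have hd : ∀ s, HasDerivAt (fun s => mgf f μ s * Real.exp (-(s * (∫ x, f x ∂μ) + s ^ 2 / 2)))
        ((∫ x, f x * Real.exp (s * f x) ∂μ) * Real.exp (-(s * (∫ x, f x ∂μ) + s ^ 2 / 2)) +
          mgf f μ s * (Real.exp (-(s * (∫ x, f x ∂μ) + s ^ 2 / 2)) * -((∫ x, f x ∂μ) + s))) s := by
      intro s
      have h1 : HasDerivAt (fun s : ℝ => -(s * (∫ x, f x ∂μ) + s ^ 2 / 2))
          (-((∫ x, f x ∂μ) + s)) s := by
        refine (((hasDerivAt_id s).mul_const (∫ x, f x ∂μ)).add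
          (((hasDerivAt_id s).pow 2).div_const 2)).neg.congr_deriv ?_
        simp
      exact (hder s).mul h1.exp
    refine antitoneOn_of_deriv_nonpos (convex_Ici _)
      (fun t _ => (hd t).continuousAt.continuousWithinAt)
      (fun t _ => (hd t).differentiableAt.differentiableWithinAt) fun s hs => ?_
    rw [interior_Ici] at hs
    rw [(hd s).deriv]
    have := mul_le_mul_of_nonneg_right (hbound s (le_of_lt hs))
      (Real.exp_pos (-(s * (∫ x, f x ∂μ) + s ^ 2 / 2))).le
    linarith
  have h := hanti (Set.mem_Ici.2 le_rfl) (Set.mem_Ici.2 ht) ht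
  simp only [mgf_zero, Real.exp_neg] at h
  rw [← div_eq_mul_inv, div_le_iff₀ (Real.exp_pos _)] at h
  simpa [mgf] using h

/-- Gaussian concentration for bounded smooth functions. -/
theorem integral_exp_le {f : EuclideanSpace ℝ ι → ℝ}
    {f' : EuclideanSpace ℝ ι → EuclideanSpace ℝ ι} {A : ℝ}
    (hf : ∀ x, HasGradientAt f (f' x) x) (hf' : Continuous f') (hA : ∀ x, |f x| ≤ A)
    (hf1 : ∀ x, ‖f' x‖ ≤ 1) (t : ℝ) :
    ∫ x, Real.exp (t * f x) ∂(stdGaussian (EuclideanSpace ℝ ι)) ≤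
      Real.exp (t * ∫ x, f x ∂(stdGaussian (EuclideanSpace ℝ ι)) + t ^ 2 / 2) := by
  rcases le_total 0 t with ht | ht
  · exact integral_exp_le_of_nonneg hf hf' hA hf1 ht
  · have h := integral_exp_le_of_nonneg (f := fun x => -f x) (f' := fun x => -f' x) (A := A)
      (fun x => by
        rw [hasGradientAt_iff_hasFDerivAt]
        refine (hf x).hasFDerivAt.neg.congr_fderiv ?_
        ext u
        simp) hf'.neg (fun x => by rw [abs_neg]; exact hA x)
      (fun x => by rw [norm_neg]; exact hf1 x) (neg_nonneg.2 ht)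
    simpa [integral_neg] using h

end Concentration

/-! ### Projections onto cones and concentration of their norms. -/

section Proj

variable {k : ℕ} (K : ProperCone ℝ (EuclideanSpace ℝ (Fin k)))

theorem proj_mem (y : EuclideanSpace ℝ (Fin k)) : proj K y ∈ K :=
  (Classical.choose_spec (exists_nearest K y)).1

theorem inner_sub_proj_sub_proj_nonpos (y : EuclideanSpace ℝ (Fin k))
    {w : EuclideanSpace ℝ (Fin k)} (hw : w ∈ K) : ⟪y - proj K y, w - proj K y⟫ ≤ 0 := by
  refine (norm_eq_iInf_iff_real_inner_le_zero K.convex (proj_mem K y)).1 ?_ w hw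
  have : Nonempty (K : Set (EuclideanSpace ℝ (Fin k))) := ⟨⟨_, proj_mem K y⟩⟩
  refine le_antisymm (le_ciInf fun w => (Classical.choose_spec (exists_nearest K y)).2 w w.2) ?_
  exact ciInf_le ⟨0, Set.forall_mem_range.2 fun _ => norm_nonneg _⟩
    (⟨_, proj_mem K y⟩ : (K : Set (EuclideanSpace ℝ (Fin k))))

/-- The variational inequality tested at 0 and at twice the projection, both in the cone, gives the
two signs. -/
theorem inner_sub_proj_proj (y : EuclideanSpace ℝ (Fin k)) : ⟪y - proj K y, proj K y⟫ = 0 := by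
  have h0 := inner_sub_proj_sub_proj_nonpos K y (w := 0) K.zero_mem
  have h2 := inner_sub_proj_sub_proj_nonpos K y
    (K.smul_mem (proj_mem K y) (zero_le_two : (0 : ℝ) ≤ 2))
  rw [zero_sub, inner_neg_right] at h0
  rw [two_smul, add_sub_cancel_right] at h2
  linarith

theorem inner_sub_proj_nonpos (y : EuclideanSpace ℝ (Fin k)) {w : EuclideanSpace ℝ (Fin k)}
    (hw : w ∈ K) : ⟪y - proj K y, w⟫ ≤ 0 := by
  have h := inner_sub_proj_sub_proj_nonpos K y hw
  rw [inner_sub_right, inner_sub_proj_proj] at h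
  linarith

theorem inner_proj_self (y : EuclideanSpace ℝ (Fin k)) : ⟪y, proj K y⟫ = ‖proj K y‖ ^ 2 := by
  have h := inner_sub_proj_proj K y
  rw [inner_sub_left, real_inner_self_eq_norm_sq] at h
  linarith

theorem inner_le_norm_proj_mul (y : EuclideanSpace ℝ (Fin k)) {w : EuclideanSpace ℝ (Fin k)}
    (hw : w ∈ K) : ⟪y, w⟫ ≤ ‖proj K y‖ * ‖w‖ := by
  have h := inner_sub_proj_nonpos K y hw
  rw [inner_sub_left] at h
  linarith [real_inner_le_norm (proj K y) w]

theorem norm_proj_sub_le (x y : EuclideanSpace ℝ (Fin k)) :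
    ‖proj K x - proj K y‖ ≤ ‖x - y‖ := by
  have h1 := inner_sub_proj_sub_proj_nonpos K x (proj_mem K y)
  have h2 := inner_sub_proj_sub_proj_nonpos K y (proj_mem K x)
  have h3 : ⟪x - y, proj K x - proj K y⟫ = ‖proj K x - proj K y‖ ^ 2 -
      ⟪x - proj K x, proj K y - proj K x⟫ - ⟪y - proj K y, proj K x - proj K y⟫ := by
    rw [← real_inner_self_eq_norm_sq, ← neg_sub (proj K x) (proj K y), inner_neg_right, sub_neg_eq_add,
      ← inner_add_left, ← inner_sub_left]
    congr 1
    abel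
  have h4 := real_inner_le_norm (x - y) (proj K x - proj K y)
  nlinarith [norm_nonneg (proj K x - proj K y), norm_nonneg (x - y)]

theorem continuous_proj : Continuous (proj K) :=
  LipschitzWith.continuous (K := 1) (LipschitzWith.of_dist_le_mul fun x y => by
    simpa [dist_eq_norm] using norm_proj_sub_le K x y)

theorem norm_proj_le (x : EuclideanSpace ℝ (Fin k)) : ‖proj K x‖ ≤ ‖x‖ := by
  have h1 := inner_proj_self K x
  have h2 := real_inner_le_norm x (proj K x)
  nlinarith [norm_nonneg x, norm_nonneg (proj K x)]

theorem proj_top (x : EuclideanSpace ℝ (Fin k)) : proj ⊤ x = x := by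
  have h := inner_sub_proj_nonpos (⊤ : ProperCone ℝ (EuclideanSpace ℝ (Fin k))) x
    (w := x - proj ⊤ x) trivial
  exact (sub_eq_zero.1 (real_inner_self_nonpos.1 h)).symm

/-- The subgradient inequality for the squared norm of the projection: bound ⟪Π(x), y⟫ by ‖Π(x)‖
‖Π(y)‖ and use 2pq ≤ p² + q². -/
theorem norm_proj_sq_ge (x y : EuclideanSpace ℝ (Fin k)) :
    ‖proj K x‖ ^ 2 + 2 * ⟪proj K x, y - x⟫ ≤ ‖proj K y‖ ^ 2 := by
  have h1 := inner_le_norm_proj_mul K y (proj_mem K x)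
  have h2 := inner_proj_self K x
  rw [inner_sub_right, real_inner_comm y, real_inner_comm x, h2]
  nlinarith [sq_nonneg (‖proj K y‖ - ‖proj K x‖)]

/-- The subgradient inequalities at x and at y enclose the increment, and nonexpansiveness makes the
gap at most 2‖y - x‖². The square is used because the norm itself can fail to be differentiable
where the projection vanishes. -/
theorem hasGradientAt_norm_proj_sq (x : EuclideanSpace ℝ (Fin k)) :
    HasGradientAt (fun y => ‖proj K y‖ ^ 2) ((2 : ℝ) • proj K x) x := by
  rw [hasGradientAt_iff_isLittleO]
  refine Asymptotics.IsBigO.trans_isLittleO (Asymptotics.IsBigO.of_bound 2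
    (Eventually.of_forall fun y => ?_)) (Asymptotics.isLittleO_pow_sub_sub x one_lt_two)
  have h1 := norm_proj_sq_ge K x y
  have h2 := norm_proj_sq_ge K y x
  have h3 : ⟪proj K y, x - y⟫ = -⟪proj K x, y - x⟫ - ⟪proj K y - proj K x, y - x⟫ := by
    rw [inner_sub_left, ← neg_sub y x, inner_neg_right]
    ring
  have h4 := real_inner_le_norm (proj K y - proj K x) (y - x)
  have h5 : ‖proj K y - proj K x‖ * ‖y - x‖ ≤ ‖y - x‖ * ‖y - x‖ :=
    mul_le_mul_of_nonneg_right (norm_proj_sub_le K y x) (norm_nonneg _)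
  rw [inner_smul_left, Real.norm_eq_abs, norm_pow, norm_norm]
  simp only [conj_trivial]
  rw [abs_le]
  constructor <;> nlinarith

/-- A bounded smooth approximation of `x ↦ ‖Π_K(x)‖`. -/
def smoothNormProj (n : ℕ) (x : EuclideanSpace ℝ (Fin k)) : ℝ :=
  √(‖proj K x‖ ^ 2 + 1 / (n + 1)) / (1 + √(‖proj K x‖ ^ 2 + 1 / (n + 1)) / (n + 1))

theorem smoothNormProj_nonneg (n : ℕ) (x : EuclideanSpace ℝ (Fin k)) :
    0 ≤ smoothNormProj K n x := by
  unfold smoothNormProj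
  positivity

theorem smoothNormProj_le (n : ℕ) (x : EuclideanSpace ℝ (Fin k)) :
    smoothNormProj K n x ≤ n + 1 := by
  unfold smoothNormProj
  rw [div_le_iff₀ (by positivity)]
  have : ((n : ℝ) + 1) * (√(‖proj K x‖ ^ 2 + 1 / (n + 1)) / (n + 1)) =
    √(‖proj K x‖ ^ 2 + 1 / (n + 1)) := by field_simp
  nlinarith [(Nat.cast_nonneg n : (0 : ℝ) ≤ n)]

theorem smoothNormProj_le_norm_add_one (n : ℕ) (x : EuclideanSpace ℝ (Fin k)) :
    smoothNormProj K n x ≤ ‖x‖ + 1 := by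
  have h1 : √(‖proj K x‖ ^ 2 + 1 / ((n : ℝ) + 1)) ≤ ‖x‖ + 1 := by
    rw [Real.sqrt_le_left (by positivity)]
    have h2 := norm_proj_le K x
    have h3 : 1 / ((n : ℝ) + 1) ≤ 1 := by
      rw [div_le_one (by positivity)]
      linarith [(Nat.cast_nonneg n : (0 : ℝ) ≤ n)]
    nlinarith [norm_nonneg (proj K x), norm_nonneg x]
  refine (div_le_self (Real.sqrt_nonneg _) ?_).trans h1
  linarith [show 0 ≤ √(‖proj K x‖ ^ 2 + 1 / ((n : ℝ) + 1)) / (n + 1) by positivity]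

theorem tendsto_smoothNormProj (x : EuclideanSpace ℝ (Fin k)) :
    Tendsto (fun n => smoothNormProj K n x) atTop (𝓝 ‖proj K x‖) := by
  have h1 : Tendsto (fun n : ℕ => 1 / ((n : ℝ) + 1)) atTop (𝓝 0) :=
    tendsto_one_div_add_atTop_nhds_zero_nat
  have h2 : Tendsto (fun n : ℕ => √(‖proj K x‖ ^ 2 + 1 / ((n : ℝ) + 1))) atTop
      (𝓝 ‖proj K x‖) := by
    have := (h1.const_add (‖proj K x‖ ^ 2)).sqrt
    rwa [add_zero, Real.sqrt_sq (norm_nonneg _)] at this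
  have h3 := h2.div ((h2.mul h1).const_add 1) (by simp)
  simp only [mul_zero, add_zero, div_one] at h3
  refine h3.congr fun n => ?_
  simp [smoothNormProj, div_eq_mul_inv]

theorem hasGradientAt_smoothNormProj (n : ℕ) (x : EuclideanSpace ℝ (Fin k)) :
    HasGradientAt (smoothNormProj K n)
      (((1 + √(‖proj K x‖ ^ 2 + 1 / (n + 1)) / (n + 1)) ^ 2)⁻¹ •
        (√(‖proj K x‖ ^ 2 + 1 / (n + 1)))⁻¹ • proj K x) x := by
  have hpos : 0 < ‖proj K x‖ ^ 2 + 1 / ((n : ℝ) + 1) := by positivity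
  have hr := Real.sqrt_pos.2 hpos
  set r := √(‖proj K x‖ ^ 2 + 1 / ((n : ℝ) + 1)) with hrdef
  have h1 : HasDerivAt (fun r : ℝ => r / (1 + r / (n + 1)))
      ((1 + r / (n + 1)) ^ 2)⁻¹ r := by
    have hne : 1 + r / ((n : ℝ) + 1) ≠ 0 := by positivity
    refine ((hasDerivAt_id r).div (((hasDerivAt_id r).div_const ((n : ℝ) + 1)).const_add 1)
      hne).congr_deriv ?_
    simp only [id]
    rw [inv_eq_one_div]
    congr 1
    ring
  have h2 : HasDerivAt (fun u : ℝ => √(u + 1 / ((n : ℝ) + 1))) (1 / (2 * r))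
      (‖proj K x‖ ^ 2) := by
    exact ((hasDerivAt_id (‖proj K x‖ ^ 2)).add_const (1 / ((n : ℝ) + 1))).sqrt hpos.ne'
  have h3 := (h1.comp (‖proj K x‖ ^ 2) h2).comp_hasFDerivAt x
    (hasGradientAt_norm_proj_sq K x).hasFDerivAt
  rw [hasGradientAt_iff_hasFDerivAt]
  refine HasFDerivAt.congr_fderiv h3 ?_
  ext u
  simp
  field_simp

theorem norm_gradient_smoothNormProj_le (n : ℕ) (x : EuclideanSpace ℝ (Fin k)) :
    ‖((1 + √(‖proj K x‖ ^ 2 + 1 / ((n : ℝ) + 1)) / (n + 1)) ^ 2)⁻¹ •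
        (√(‖proj K x‖ ^ 2 + 1 / (n + 1)))⁻¹ • proj K x‖ ≤ 1 := by
  have hr : 0 < √(‖proj K x‖ ^ 2 + 1 / ((n : ℝ) + 1)) := Real.sqrt_pos.2 (by positivity)
  rw [norm_smul, norm_smul, Real.norm_of_nonneg (by positivity), Real.norm_of_nonneg (by positivity)]
  refine mul_le_one₀ (inv_le_one_of_one_le₀ ?_) (by positivity) ?_
  · refine one_le_pow₀ ?_
    linarith [show 0 ≤ √(‖proj K x‖ ^ 2 + 1 / ((n : ℝ) + 1)) / (n + 1) by positivity]
  · rw [inv_mul_le_iff₀ hr, mul_one]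
    refine Real.le_sqrt_of_sq_le ?_
    linarith [show 0 ≤ 1 / ((n : ℝ) + 1) by positivity]

theorem integrable_norm_stdGaussian :
    Integrable (fun x => ‖x‖) (stdGaussian (EuclideanSpace ℝ (Fin k))) :=
  (IsGaussian.integrable_id (μ := stdGaussian (EuclideanSpace ℝ (Fin k)))).norm

theorem integrable_norm_proj :
    Integrable (fun x => ‖proj K x‖) (stdGaussian (EuclideanSpace ℝ (Fin k))) :=
  integrable_norm_stdGaussian.mono (continuous_proj K).norm.aestronglyMeasurable
    (ae_of_all _ fun x => by simpa using norm_proj_le K x)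

/-- The norm of the projection of a standard Gaussian vector onto a closed convex cone is
sub-Gaussian about the Gaussian width, with variance proxy `1`. -/
theorem lintegral_exp_norm_proj_le (t : ℝ) :
    ∫⁻ x, ENNReal.ofReal (Real.exp (t * ‖proj K x‖)) ∂(stdGaussian (EuclideanSpace ℝ (Fin k))) ≤
      ENNReal.ofReal (Real.exp (t * gaussianWidth K + t ^ 2 / 2)) := by
  set μ := stdGaussian (EuclideanSpace ℝ (Fin k)) with hμ
  have hc : ∀ n, Continuous (smoothNormProj K n) := fun n =>
    continuous_iff_continuousAt.2 fun x =>
      (hasGradientAt_smoothNormProj K n x).differentiableAt.continuousAt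
  have hlim : Tendsto (fun n => ∫ x, smoothNormProj K n x ∂μ) atTop (𝓝 (gaussianWidth K)) := by
    refine tendsto_integral_of_dominated_convergence (fun x => ‖x‖ + 1)
      (fun n => (hc n).aestronglyMeasurable)
      (integrable_norm_stdGaussian.add (integrable_const 1))
      (fun n => ae_of_all _ fun x => ?_) (ae_of_all _ fun x => tendsto_smoothNormProj K x)
    rw [Real.norm_of_nonneg (smoothNormProj_nonneg K n x)]
    exact smoothNormProj_le_norm_add_one K n x
  have hn : ∀ n, ∫⁻ x, ENNReal.ofReal (Real.exp (t * smoothNormProj K n x)) ∂μ ≤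
      ENNReal.ofReal (Real.exp (t * ∫ x, smoothNormProj K n x ∂μ + t ^ 2 / 2)) := by
    intro n
    have hA : ∀ x, |smoothNormProj K n x| ≤ n + 1 := fun x => by
      rw [abs_of_nonneg (smoothNormProj_nonneg K n x)]
      exact smoothNormProj_le K n x
    have hi : Integrable (fun x => Real.exp (t * smoothNormProj K n x)) μ :=
      integrable_exp_mul_of_mem_Icc (a := -((n : ℝ) + 1)) (b := n + 1) (hc n).aemeasurable
        (ae_of_all _ fun x => abs_le.1 (hA x))
    rw [← ofReal_integral_eq_lintegral_ofReal hi (ae_of_all _ fun x => (Real.exp_pos _).le)]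
    refine ENNReal.ofReal_le_ofReal (integral_exp_le (A := (n : ℝ) + 1)
      (hasGradientAt_smoothNormProj K n) ?_ hA (norm_gradient_smoothNormProj_le K n) t)
    have hp := continuous_proj K
    have h1 : ∀ x, (1 + √(‖proj K x‖ ^ 2 + 1 / ((n : ℝ) + 1)) / (n + 1)) ^ 2 ≠ 0 := fun x => by
      positivity
    have h2 : ∀ x, √(‖proj K x‖ ^ 2 + 1 / ((n : ℝ) + 1)) ≠ 0 := fun x =>
      (Real.sqrt_pos.2 (by positivity)).ne'
    exact ((by fun_prop : Continuous fun x =>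
      (1 + √(‖proj K x‖ ^ 2 + 1 / ((n : ℝ) + 1)) / (n + 1)) ^ 2).inv₀ h1).smul
      (((by fun_prop : Continuous fun x => √(‖proj K x‖ ^ 2 + 1 / ((n : ℝ) + 1))).inv₀ h2).smul hp)
  -- The means converge by domination, but for the exponentials an upper bound suffices, so Fatou
  -- avoids any prior integrability.
  calc ∫⁻ x, ENNReal.ofReal (Real.exp (t * ‖proj K x‖)) ∂μ
      = ∫⁻ x, liminf (fun n => ENNReal.ofReal (Real.exp (t * smoothNormProj K n x))) atTop ∂μ := by
        refine lintegral_congr fun x => (Tendsto.liminf_eq ?_).symm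
        exact ENNReal.tendsto_ofReal ((Real.continuous_exp.tendsto _).comp
          ((tendsto_smoothNormProj K x).const_mul t))
    _ ≤ liminf (fun n => ∫⁻ x, ENNReal.ofReal (Real.exp (t * smoothNormProj K n x)) ∂μ) atTop :=
        lintegral_liminf_le fun n => by
          have := hc n
          fun_prop
    _ ≤ liminf (fun n => ENNReal.ofReal
          (Real.exp (t * ∫ x, smoothNormProj K n x ∂μ + t ^ 2 / 2))) atTop :=
        liminf_le_liminf (Eventually.of_forall hn)
    _ = _ := Tendsto.liminf_eq (ENNReal.tendsto_ofReal ((Real.continuous_exp.tendsto _).comp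
          ((hlim.const_mul t).add_const _)))

end Proj

/-! ### Gordon's inequality for Gaussian matrices, in exponential form. -/

section MatrixGordon

variable {n m : ℕ}

theorem measurable_matrix_entry (i : Fin n) (j : Fin m) :
    Measurable fun M : Matrix (Fin n) (Fin m) ℝ => M i j :=
  (measurable_pi_apply (X := fun _ : Fin m => ℝ) j).comp
    (measurable_pi_apply (X := fun _ : Fin n => Fin m → ℝ) i)

/-- The matrix with given entries. -/
def matOf (ξ : Fin n × Fin m → ℝ) : Matrix (Fin n) (Fin m) ℝ := fun i j => ξ (i, j)

theorem measurable_matOf : Measurable (matOf : (Fin n × Fin m → ℝ) → Matrix (Fin n) (Fin m) ℝ) :=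
  measurable_pi_lambda _ fun i => measurable_pi_lambda _ fun j => measurable_pi_apply (i, j)

variable (n m) in
/-- The law of a Gaussian random matrix. -/
def matGaussian : Measure (Matrix (Fin n) (Fin m) ℝ) := (stdPi (Fin n × Fin m)).map matOf

instance : IsProbabilityMeasure (matGaussian n m) :=
  Measure.isProbabilityMeasure_map measurable_matOf.aemeasurable

theorem IsGaussianMatrix.map_eq {Ω : Type*} [MeasurableSpace Ω] {P : Measure Ω}
    [IsProbabilityMeasure P] {G : Ω → Matrix (Fin n) (Fin m) ℝ} (hG : IsGaussianMatrix G P) :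
    P.map G = matGaussian n m := by
  have hm : ∀ p : Fin n × Fin m, Measurable fun ω => G ω p.1 p.2 := fun p =>
    (measurable_matrix_entry p.1 p.2).comp hG.measurable
  have h := (iIndepFun_iff_map_fun_eq_pi_map fun p => (hm p).aemeasurable).1 hG.indep
  simp_rw [fun p : Fin n × Fin m => (hG.hasLaw p.1 p.2).map_eq] at h
  rw [matGaussian, stdPi, ← h, Measure.map_map measurable_matOf (measurable_pi_lambda _ hm)]
  rfl

theorem inner_toEuclideanLin (y : EuclideanSpace ℝ (Fin n)) (M : Matrix (Fin n) (Fin m) ℝ)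
    (x : EuclideanSpace ℝ (Fin m)) :
    ⟪y, Matrix.toEuclideanLin M x⟫ = ∑ p : Fin n × Fin m, y p.1 * x p.2 * M p.1 p.2 := by
  rw [Fintype.sum_prod_type]
  simp only [PiLp.inner_apply, Matrix.toLpLin_apply, Matrix.mulVec, dotProduct]
  refine Finset.sum_congr rfl fun i _ => ?_
  simp [Finset.sum_mul]
  exact Finset.sum_congr rfl fun j _ => by ring

theorem measurable_inner_toEuclideanLin (y : EuclideanSpace ℝ (Fin n))
    (x : EuclideanSpace ℝ (Fin m)) :
    Measurable fun M : Matrix (Fin n) (Fin m) ℝ => ⟪y, Matrix.toEuclideanLin M x⟫ := by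
  simp_rw [inner_toEuclideanLin]
  exact Finset.measurable_sum _ fun p _ => (measurable_matrix_entry p.1 p.2).const_mul _

theorem measurable_toEuclideanLin (x : EuclideanSpace ℝ (Fin m)) :
    Measurable fun M : Matrix (Fin n) (Fin m) ℝ => Matrix.toEuclideanLin M x := by
  have : Measurable fun (M : Matrix (Fin n) (Fin m) ℝ) (i : Fin n) => ∑ j, M i j * x j :=
    measurable_pi_lambda _ fun i => Finset.measurable_sum _ fun j _ =>
      (measurable_matrix_entry i j).mul_const _
  exact (WithLp.measurable_toLp 2 (Fin n → ℝ)).comp this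

/-- Gordon's comparison of `⟪y, G x⟫ + γ` and `⟪y, g⟫ - ⟪x, h⟫`. -/
theorem measureReal_le_of_gordon {I J : Type*} [Fintype I] [Fintype J]
    {x : I → EuclideanSpace ℝ (Fin m)} {y : I → J → EuclideanSpace ℝ (Fin n)}
    (hx : ∀ i, ‖x i‖ = 1) (hy : ∀ i j, ‖y i j‖ ≤ 1)
    {S : Matrix (Fin n) (Fin m) ℝ → ℝ} {p : EuclideanSpace ℝ (Fin n) → ℝ}
    {q : EuclideanSpace ℝ (Fin m) → ℝ} (hSm : Measurable S) (hpm : Measurable p)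
    (hqm : Measurable q)
    (hS : ∀ M u, (∀ i, ∃ j, u ≤ ⟪y i j, Matrix.toEuclideanLin M (x i)⟫) → u ≤ S M)
    (hpq : ∀ g h i, ∃ j, p g - q h ≤ ⟪y i j, g⟫ - ⟪x i, h⟫) (u : ℝ) :
    ((stdGaussian (EuclideanSpace ℝ (Fin n))).prod
      (stdGaussian (EuclideanSpace ℝ (Fin m)))).real {z | u ≤ p z.1 - q z.2} ≤
    ((matGaussian n m).prod (gaussianReal 0 1)).real {z | u ≤ S z.1 + z.2} := by
  -- The `Unit` coordinate is the auxiliary γ. It adds 1 to every covariance, so the difference from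
  -- the covariance of `B` is (1 - ⟪y, y'⟫)(1 - ⟪x, x'⟫). This is nonnegative on the unit balls and
  -- zero when x = x' is a unit vector; the y need not be unit vectors.
  let A : I × J → (Fin n × Fin m) ⊕ Unit → ℝ := fun a =>
    Sum.elim (fun r => y a.1 a.2 r.1 * x a.1 r.2) fun _ => 1
  let B : I × J → Fin n ⊕ Fin m → ℝ := fun a =>
    Sum.elim (fun r => y a.1 a.2 r) fun c => -x a.1 c
  have hA : ∀ a b, ∑ k, A a k * A b k = ⟪y a.1 a.2, y b.1 b.2⟫ * ⟪x a.1, x b.1⟫ + 1 := by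
    intro a b
    simp only [A, Fintype.sum_sum_type, Sum.elim_inl, Sum.elim_inr, PiLp.inner_apply,
      Fintype.sum_prod_type, Finset.sum_mul_sum]
    simp only [Finset.univ_unique, mul_one, Finset.sum_const, Finset.card_singleton, one_smul,
      add_left_inj]
    refine Finset.sum_congr rfl fun i _ => Finset.sum_congr rfl fun j _ => ?_
    simp
    ring
  have hB : ∀ a b, ∑ k, B a k * B b k = ⟪y a.1 a.2, y b.1 b.2⟫ + ⟪x a.1, x b.1⟫ := by
    intro a b
    simp only [B, Fintype.sum_sum_type, Sum.elim_inl, Sum.elim_inr, PiLp.inner_apply]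
    congr 1 <;> exact Finset.sum_congr rfl fun i _ => by simp [mul_comm]
  have hinner : ∀ {E : Type} [NormedAddCommGroup E] [InnerProductSpace ℝ E] (v w : E),
      ‖v‖ ≤ 1 → ‖w‖ ≤ 1 → ⟪v, w⟫ ≤ 1 := fun v w hv hw =>
    (real_inner_le_norm v w).trans (mul_le_one₀ hv (norm_nonneg _) hw)
  have hg := measureReal_forall_exists_le (A := A) (B := B)
    (fun a b hab => by
      rw [hA, hB, hab, real_inner_self_eq_norm_sq, hx]
      ring)
    (fun a b _ => by
      rw [hA, hB]
      have h1 := hinner _ _ (hy a.1 a.2) (hy b.1 b.2)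
      have h2 := hinner _ _ (hx a.1).le (hx b.1).le
      nlinarith) u
  have hApp : ∀ ξ : (Fin n × Fin m) ⊕ Unit → ℝ, ∀ i j, ∑ k, A (i, j) k * ξ k =
      ⟪y i j, Matrix.toEuclideanLin (matOf fun r => ξ (Sum.inl r)) (x i)⟫ + ξ (Sum.inr ()) := by
    intro ξ i j
    rw [inner_toEuclideanLin]
    simp [A, Fintype.sum_sum_type, matOf]
  have hBpp : ∀ ξ : Fin n ⊕ Fin m → ℝ, ∀ i j, ∑ k, B (i, j) k * ξ k =
      ⟪y i j, WithLp.toLp 2 fun r => ξ (Sum.inl r)⟫ -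
        ⟪x i, WithLp.toLp 2 fun c => ξ (Sum.inr c)⟫ := by
    intro ξ i j
    simp [B, Fintype.sum_sum_type, PiLp.inner_apply, mul_comm, sub_eq_add_neg]
  have hmp₁ : MeasurePreserving (fun ξ : (Fin n × Fin m) ⊕ Unit → ℝ =>
      ((matOf fun r => ξ (Sum.inl r) : Matrix (Fin n) (Fin m) ℝ), ξ (Sum.inr ())))
      (stdPi _) ((matGaussian n m).prod (gaussianReal 0 1)) :=
    (MeasurePreserving.prod (⟨measurable_matOf, rfl⟩ : MeasurePreserving matOf
        (stdPi (Fin n × Fin m)) (matGaussian n m))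
      (measurePreserving_funUnique (gaussianReal 0 1) Unit)).comp
      (measurePreserving_sumPiEquivProdPi fun _ : (Fin n × Fin m) ⊕ Unit => gaussianReal 0 1)
  have hmp₂ : MeasurePreserving (fun ξ : Fin n ⊕ Fin m → ℝ =>
      ((WithLp.toLp 2 fun r => ξ (Sum.inl r) : EuclideanSpace ℝ (Fin n)),
        (WithLp.toLp 2 fun c => ξ (Sum.inr c) : EuclideanSpace ℝ (Fin m))))
      (stdPi _) ((stdGaussian (EuclideanSpace ℝ (Fin n))).prod
        (stdGaussian (EuclideanSpace ℝ (Fin m)))) :=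
    (MeasurePreserving.prod
      (⟨WithLp.measurable_toLp 2 _, map_pi_eq_stdGaussian⟩ : MeasurePreserving (WithLp.toLp 2)
        (stdPi (Fin n)) (stdGaussian (EuclideanSpace ℝ (Fin n))))
      (⟨WithLp.measurable_toLp 2 _, map_pi_eq_stdGaussian⟩ : MeasurePreserving (WithLp.toLp 2)
        (stdPi (Fin m)) (stdGaussian (EuclideanSpace ℝ (Fin m))))).comp
      (measurePreserving_sumPiEquivProdPi fun _ : Fin n ⊕ Fin m => gaussianReal 0 1)
  rw [← hmp₁.measureReal_preimage (measurableSet_le measurable_const (by fun_prop)).nullMeasurableSet,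
    ← hmp₂.measureReal_preimage (measurableSet_le measurable_const (by fun_prop)).nullMeasurableSet]
  refine (measureReal_mono ?_).trans (hg.trans (measureReal_mono ?_))
  · intro ξ hξ i
    obtain ⟨j, hj⟩ := hpq (WithLp.toLp 2 fun r => ξ (Sum.inl r))
      (WithLp.toLp 2 fun c => ξ (Sum.inr c)) i
    exact ⟨j, by rw [hBpp]; exact le_trans hξ hj⟩
  · intro ξ hξ
    have := hS (matOf fun r => ξ (Sum.inl r)) (u - ξ (Sum.inr ())) fun i => by
      obtain ⟨j, hj⟩ := hξ i
      exact ⟨j, by rw [hApp] at hj; linarith⟩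
    show u ≤ _
    simp only
    linarith

/-- Stochastic domination carries over to exponential moments. -/
theorem lintegral_exp_neg_le_of_measureReal_le {α β : Type*} [MeasurableSpace α]
    [MeasurableSpace β] {μ : Measure α} {ν : Measure β} [IsProbabilityMeasure μ]
    [IsProbabilityMeasure ν] {X : α → ℝ} {Y : β → ℝ} (hX : Measurable X) (hY : Measurable Y)
    (h : ∀ u, ν.real {z | u ≤ Y z} ≤ μ.real {z | u ≤ X z}) {t : ℝ} (ht : 0 < t) :
    ∫⁻ z, ENNReal.ofReal (Real.exp (-t * X z)) ∂μ ≤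
      ∫⁻ z, ENNReal.ofReal (Real.exp (-t * Y z)) ∂ν := by
  rw [lintegral_eq_lintegral_meas_lt μ (ae_of_all _ fun _ => (Real.exp_pos _).le) (by fun_prop),
    lintegral_eq_lintegral_meas_lt ν (ae_of_all _ fun _ => (Real.exp_pos _).le) (by fun_prop)]
  refine setLIntegral_mono' measurableSet_Ioi fun r hr => ?_
  have hr' : 0 < r := hr
  have e1 : {z | r < Real.exp (-t * X z)} = {z | -Real.log r / t ≤ X z}ᶜ := by
    ext z
    change r < Real.exp (-t * X z) ↔ ¬ (-Real.log r / t ≤ X z)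
    rw [not_le, lt_div_iff₀ ht, ← Real.log_lt_iff_lt_exp hr']
    constructor <;> intro h <;> linarith
  have e2 : {z | r < Real.exp (-t * Y z)} = {z | -Real.log r / t ≤ Y z}ᶜ := by
    ext z
    change r < Real.exp (-t * Y z) ↔ ¬ (-Real.log r / t ≤ Y z)
    rw [not_le, lt_div_iff₀ ht, ← Real.log_lt_iff_lt_exp hr']
    constructor <;> intro h <;> linarith
  rw [e1, e2, ← ENNReal.toReal_le_toReal (measure_ne_top _ _) (measure_ne_top _ _)]
  change μ.real _ ≤ ν.real _
  rw [probReal_compl_eq_one_sub (measurableSet_le measurable_const hX),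
    probReal_compl_eq_one_sub (measurableSet_le measurable_const hY)]
  linarith [h (-Real.log r / t)]

theorem lintegral_exp_gaussianReal (t : ℝ) :
    ∫⁻ z, ENNReal.ofReal (Real.exp (t * z)) ∂(gaussianReal 0 1) =
      ENNReal.ofReal (Real.exp (t ^ 2 / 2)) := by
  rw [← ofReal_integral_eq_lintegral_ofReal (integrable_exp_mul_gaussianReal t)
    (ae_of_all _ fun _ => (Real.exp_pos _).le)]
  have := congrFun (mgf_id_gaussianReal (μ := 0) (v := 1)) t
  simp only [mgf, id] at this
  rw [this]
  simp

/-- Gordon's comparison inequality for exponential moments. -/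
theorem lintegral_exp_neg_le_of_gordon {I J : Type*} [Fintype I] [Fintype J]
    {x : I → EuclideanSpace ℝ (Fin m)} {y : I → J → EuclideanSpace ℝ (Fin n)}
    (hx : ∀ i, ‖x i‖ = 1) (hy : ∀ i j, ‖y i j‖ ≤ 1)
    {S : Matrix (Fin n) (Fin m) ℝ → ℝ} {p : EuclideanSpace ℝ (Fin n) → ℝ}
    {q : EuclideanSpace ℝ (Fin m) → ℝ} (hSm : Measurable S) (hpm : Measurable p)
    (hqm : Measurable q)
    (hS : ∀ M u, (∀ i, ∃ j, u ≤ ⟪y i j, Matrix.toEuclideanLin M (x i)⟫) → u ≤ S M)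
    (hpq : ∀ g h i, ∃ j, p g - q h ≤ ⟪y i j, g⟫ - ⟪x i, h⟫) {t : ℝ} (ht : 0 < t) :
    (∫⁻ M, ENNReal.ofReal (Real.exp (-t * S M)) ∂(matGaussian n m)) *
        ENNReal.ofReal (Real.exp (t ^ 2 / 2)) ≤
      (∫⁻ g, ENNReal.ofReal (Real.exp (-t * p g)) ∂(stdGaussian (EuclideanSpace ℝ (Fin n)))) *
        ∫⁻ h, ENNReal.ofReal (Real.exp (t * q h)) ∂(stdGaussian (EuclideanSpace ℝ (Fin m))) := by
  have h := lintegral_exp_neg_le_of_measureReal_le (μ := (matGaussian n m).prod (gaussianReal 0 1))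
    (ν := (stdGaussian (EuclideanSpace ℝ (Fin n))).prod (stdGaussian (EuclideanSpace ℝ (Fin m))))
    (X := fun z => S z.1 + z.2) (Y := fun z => p z.1 - q z.2) (by fun_prop) (by fun_prop)
    (measureReal_le_of_gordon hx hy hSm hpm hqm hS hpq) ht
  -- Independence turns both exponential moments into products; the factor exp(t²/2) is that of γ.
  rw [show t ^ 2 / 2 = (-t) ^ 2 / 2 by ring, ← lintegral_exp_gaussianReal,
    ← lintegral_prod_mul (by fun_prop) (by fun_prop),
    ← lintegral_prod_mul (by fun_prop) (by fun_prop)]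
  convert h using 4 with z z
  · rw [← ENNReal.ofReal_mul (Real.exp_pos _).le, ← Real.exp_add, mul_add]
  · rw [← ENNReal.ofReal_mul (Real.exp_pos _).le, ← Real.exp_add]
    congr 2
    ring

end MatrixGordon

/-! ### Countable suprema and their passage to the limit. -/

section DenseSup

/-- Replacing a supremum over a set of vectors by one over a dense sequence makes it measurable and
a limit of finite maxima, to which the finite form of Gordon's inequality applies. -/
theorem le_ciSup_denseSeq {X : Type*} [TopologicalSpace X] [TopologicalSpace.SeparableSpace X]
    [Nonempty X] {f : X → ℝ} (hf : Continuous f) (hb : BddAbove (Set.range f)) (x : X) :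
    f x ≤ ⨆ i, f (TopologicalSpace.denseSeq X i) := by
  have hcl : IsClosed {x | f x ≤ ⨆ i, f (TopologicalSpace.denseSeq X i)} :=
    isClosed_le hf continuous_const
  have hsub : Set.range (TopologicalSpace.denseSeq X) ⊆
      {x | f x ≤ ⨆ i, f (TopologicalSpace.denseSeq X i)} := by
    rintro _ ⟨i, rfl⟩
    exact le_ciSup (f := fun i => f (TopologicalSpace.denseSeq X i))
      (hb.mono (Set.range_comp_subset_range _ f)) i
  exact hcl.closure_subset_iff.2 hsub (TopologicalSpace.denseRange_denseSeq X x)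

theorem tendsto_partialSups {a : ℕ → ℝ} {L : ℝ} (h : IsLUB (Set.range a) L) :
    Tendsto (fun k => partialSups a k) atTop (𝓝 L) := by
  refine tendsto_atTop_isLUB (partialSups_monotone a) ?_
  rwa [IsLUB, upperBounds_range_partialSups]

theorem exists_le_eq_partialSups (a : ℕ → ℝ) (k : ℕ) : ∃ i ≤ k, a i = partialSups a k := by
  rw [partialSups_eq_sup'_range]
  obtain ⟨i, hi, h⟩ := Finset.exists_mem_eq_sup' (s := Finset.range (k + 1)) ⟨0, by simp⟩ a
  exact ⟨i, by simpa [Nat.lt_succ_iff] using hi, h.symm⟩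

theorem measurable_partialSups {α : Type*} [MeasurableSpace α] {a : ℕ → α → ℝ}
    (ha : ∀ i, Measurable (a i)) (k : ℕ) : Measurable fun x => partialSups (fun i => a i x) k := by
  induction k with
  | zero => simpa using ha 0
  | succ k ih =>
    simp only [partialSups_add_one]
    exact ih.sup (ha _)

/-- A consequence of Fatou's lemma. -/
theorem lintegral_le_of_tendsto {α : Type*} [MeasurableSpace α] {μ : Measure α}
    {F : ℕ → α → ℝ≥0∞} {f : α → ℝ≥0∞} {c : ℝ≥0∞} (hF : ∀ n, Measurable (F n))
    (hlim : ∀ x, Tendsto (fun n => F n x) atTop (𝓝 (f x))) (hc : ∀ n, ∫⁻ x, F n x ∂μ ≤ c) :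
    ∫⁻ x, f x ∂μ ≤ c := by
  calc ∫⁻ x, f x ∂μ = ∫⁻ x, liminf (fun n => F n x) atTop ∂μ :=
        lintegral_congr fun x => (hlim x).liminf_eq.symm
    _ ≤ liminf (fun n => ∫⁻ x, F n x ∂μ) atTop := lintegral_liminf_le hF
    _ ≤ c := liminf_le_of_le (by isBoundedDefault) fun b hb => by
        obtain ⟨n, hn⟩ := hb.exists
        exact hn.trans (hc n)

theorem tendsto_ofReal_exp_mul {a : ℕ → ℝ} {L : ℝ} (h : Tendsto a atTop (𝓝 L)) (t : ℝ) :
    Tendsto (fun n => ENNReal.ofReal (Real.exp (t * a n))) atTop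
      (𝓝 (ENNReal.ofReal (Real.exp (t * L)))) :=
  ENNReal.tendsto_ofReal ((Real.continuous_exp.tendsto _).comp (h.const_mul t))

/-- Cancels an exponential factor, such as that of γ in Gordon's inequality. -/
theorem le_of_mul_ofReal_exp_le {c : ℝ≥0∞} {r s : ℝ}
    (h : c * ENNReal.ofReal (Real.exp r) ≤ ENNReal.ofReal (Real.exp s)) :
    c ≤ ENNReal.ofReal (Real.exp (s - r)) := by
  calc c = c * ENNReal.ofReal (Real.exp r) * ENNReal.ofReal (Real.exp (-r)) := by
        rw [mul_assoc, ← ENNReal.ofReal_mul (Real.exp_pos _).le, ← Real.exp_add]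
        simp
    _ ≤ ENNReal.ofReal (Real.exp s) * ENNReal.ofReal (Real.exp (-r)) := by gcongr
    _ = _ := by
        rw [← ENNReal.ofReal_mul (Real.exp_pos _).le, ← Real.exp_add, sub_eq_add_neg]

end DenseSup

/-! ### The restricted singular value is sub-Gaussian from below. -/

section Cones

variable {n m : ℕ}

/-- The unit vectors of a cone. -/
abbrev ConeSphere (C : ProperCone ℝ (EuclideanSpace ℝ (Fin m))) : Type :=
  {x : EuclideanSpace ℝ (Fin m) // x ∈ C ∧ ‖x‖ = 1}

/-- The vectors of a cone of norm at most one. -/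
abbrev ConeBall (D : ProperCone ℝ (EuclideanSpace ℝ (Fin n))) : Type :=
  {y : EuclideanSpace ℝ (Fin n) // y ∈ D ∧ ‖y‖ ≤ 1}

instance (D : ProperCone ℝ (EuclideanSpace ℝ (Fin n))) : Nonempty (ConeBall D) :=
  ⟨⟨0, D.zero_mem, by simp⟩⟩

/-- The normalised projection is a maximiser, and 0 is one if the projection vanishes. Hence the
ball of the cone and not its sphere, on which the supremum could be negative. -/
theorem exists_inner_eq_norm_proj (D : ProperCone ℝ (EuclideanSpace ℝ (Fin n)))
    (g : EuclideanSpace ℝ (Fin n)) : ∃ y : ConeBall D, ⟪(y : EuclideanSpace ℝ (Fin n)), g⟫ =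
      ‖proj D g‖ := by
  by_cases h : proj D g = 0
  · exact ⟨⟨0, D.zero_mem, by simp⟩, by simp [h]⟩
  · have hpos : 0 < ‖proj D g‖ := norm_pos_iff.2 h
    refine ⟨⟨‖proj D g‖⁻¹ • proj D g, D.smul_mem (proj_mem D g) (by positivity), ?_⟩, ?_⟩
    · rw [norm_smul, norm_inv, norm_norm, inv_mul_cancel₀ hpos.ne']
    · simp only [inner_smul_left, conj_trivial]
      rw [real_inner_comm, inner_proj_self]
      field_simp

theorem inner_le_norm_proj (D : ProperCone ℝ (EuclideanSpace ℝ (Fin n)))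
    (g : EuclideanSpace ℝ (Fin n)) (y : ConeBall D) :
    ⟪(y : EuclideanSpace ℝ (Fin n)), g⟫ ≤ ‖proj D g‖ := by
  rw [real_inner_comm]
  exact (inner_le_norm_proj_mul D g y.2.1).trans (mul_le_of_le_one_right (norm_nonneg _) y.2.2)

theorem isLUB_inner_denseSeq (D : ProperCone ℝ (EuclideanSpace ℝ (Fin n)))
    (g : EuclideanSpace ℝ (Fin n)) :
    IsLUB (Set.range fun i => ⟪(TopologicalSpace.denseSeq (ConeBall D) i :
      EuclideanSpace ℝ (Fin n)), g⟫) ‖proj D g‖ := by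
  have hb : ∀ y : ConeBall D, ⟪(y : EuclideanSpace ℝ (Fin n)), g⟫ ≤ ‖proj D g‖ :=
    inner_le_norm_proj D g
  obtain ⟨y, hy⟩ := exists_inner_eq_norm_proj D g
  have h1 := le_ciSup_denseSeq (f := fun y : ConeBall D => ⟪(y : EuclideanSpace ℝ (Fin n)), g⟫)
    (by fun_prop) ⟨_, Set.forall_mem_range.2 hb⟩ y
  have h2 : ‖proj D g‖ = ⨆ i, ⟪(TopologicalSpace.denseSeq (ConeBall D) i :
      EuclideanSpace ℝ (Fin n)), g⟫ :=
    le_antisymm (hy ▸ h1) (ciSup_le fun i => hb _)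
  rw [h2]
  exact isLUB_ciSup ⟨_, Set.forall_mem_range.2 fun i => hb _⟩

variable (C : ProperCone ℝ (EuclideanSpace ℝ (Fin m)))
  (D : ProperCone ℝ (EuclideanSpace ℝ (Fin n))) [Nonempty (ConeSphere C)]

/-- The smallest restricted singular value, as a real number and as the infimum over a countable
dense set of unit vectors. -/
def realSing (M : Matrix (Fin n) (Fin m) ℝ) : ℝ :=
  ⨅ i, ‖proj D (Matrix.toEuclideanLin M
    (TopologicalSpace.denseSeq (ConeSphere C) i : EuclideanSpace ℝ (Fin m)))‖

theorem bddBelow_range_norm {ι E : Type*} [SeminormedAddCommGroup E] (f : ι → E) :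
    BddBelow (Set.range fun i => ‖f i‖) :=
  ⟨0, Set.forall_mem_range.2 fun _ => norm_nonneg _⟩

theorem measurable_norm_proj_toEuclideanLin (x : EuclideanSpace ℝ (Fin m)) :
    Measurable fun M : Matrix (Fin n) (Fin m) ℝ => ‖proj D (Matrix.toEuclideanLin M x)‖ :=
  ((continuous_proj D).measurable.comp (measurable_toEuclideanLin x)).norm

theorem measurable_realSing : Measurable (realSing C D) :=
  Measurable.iInf fun _ => measurable_norm_proj_toEuclideanLin D _

theorem realSing_le (M : Matrix (Fin n) (Fin m) ℝ) (x : ConeSphere C) :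
    realSing C D M ≤ ‖proj D (Matrix.toEuclideanLin M (x : EuclideanSpace ℝ (Fin m)))‖ := by
  have hcont : Continuous fun x : ConeSphere C =>
      ‖proj D (Matrix.toEuclideanLin M (x : EuclideanSpace ℝ (Fin m)))‖ :=
    ((continuous_proj D).comp ((Matrix.toEuclideanLin M).continuous_of_finiteDimensional.comp
      continuous_subtype_val)).norm
  have hcl := isClosed_le (continuous_const (y := realSing C D M)) hcont
  have hsub : Set.range (TopologicalSpace.denseSeq (ConeSphere C)) ⊆ {x | realSing C D M ≤
      ‖proj D (Matrix.toEuclideanLin M (x : EuclideanSpace ℝ (Fin m)))‖} := by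
    rintro _ ⟨i, rfl⟩
    exact ciInf_le (bddBelow_range_norm _) i
  exact hcl.closure_subset_iff.2 hsub (TopologicalSpace.denseRange_denseSeq _ x)

theorem tendsto_neg_partialSups_realSing (M : Matrix (Fin n) (Fin m) ℝ) :
    Tendsto (fun k => -partialSups (fun i => -‖proj D (Matrix.toEuclideanLin M
      (TopologicalSpace.denseSeq (ConeSphere C) i : EuclideanSpace ℝ (Fin m)))‖) k) atTop
      (𝓝 (realSing C D M)) := by
  rw [← neg_neg (realSing C D M)]
  refine (tendsto_partialSups ⟨?_, fun b hb => ?_⟩).neg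
  · rintro _ ⟨i, rfl⟩
    exact neg_le_neg (ciInf_le (bddBelow_range_norm _) i)
  · rw [neg_le]
    exact le_ciInf fun i => neg_le.1 (hb ⟨i, rfl⟩)

/-- Finite Gordon with the first k + 1 points x and l + 1 points y. On the matrix side the maximum
over y may be enlarged at once to the norm of the projection, so `l` survives only on the side of
the vector g. -/
theorem lintegral_exp_neg_partialSups_le (C : ProperCone ℝ (EuclideanSpace ℝ (Fin m)))
    (D : ProperCone ℝ (EuclideanSpace ℝ (Fin n))) {xs : ℕ → EuclideanSpace ℝ (Fin m)}
    {ys : ℕ → EuclideanSpace ℝ (Fin n)} (hxC : ∀ i, xs i ∈ C) (hx : ∀ i, ‖xs i‖ = 1)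
    (hyD : ∀ j, ys j ∈ D) (hy : ∀ j, ‖ys j‖ ≤ 1) (k l : ℕ) {t : ℝ} (ht : 0 < t) :
    (∫⁻ M, ENNReal.ofReal (Real.exp (-t * -partialSups (fun i =>
        -‖proj D (Matrix.toEuclideanLin M (xs i))‖) k)) ∂(matGaussian n m)) *
        ENNReal.ofReal (Real.exp (t ^ 2 / 2)) ≤
      (∫⁻ g, ENNReal.ofReal (Real.exp (-t * partialSups (fun j => ⟪ys j, g⟫) l))
        ∂(stdGaussian (EuclideanSpace ℝ (Fin n)))) *
        ∫⁻ h, ENNReal.ofReal (Real.exp (t * ‖proj C h‖))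
          ∂(stdGaussian (EuclideanSpace ℝ (Fin m))) := by
  have hSm : Measurable fun M : Matrix (Fin n) (Fin m) ℝ => -partialSups (fun i =>
        -‖proj D (Matrix.toEuclideanLin M (xs i))‖) k :=
    (measurable_partialSups (fun i => (measurable_norm_proj_toEuclideanLin D _).neg) k).neg
  have hpm : Measurable fun g : EuclideanSpace ℝ (Fin n) => partialSups (fun j => ⟪ys j, g⟫) l :=
    measurable_partialSups (fun j => by fun_prop) l
  have hqm : Measurable fun h : EuclideanSpace ℝ (Fin m) => ‖proj C h‖ :=
    (continuous_proj C).norm.measurable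
  refine lintegral_exp_neg_le_of_gordon (I := Fin (k + 1)) (J := Fin (l + 1))
    (x := fun i => xs i) (y := fun _ j => ys j) (fun i => hx i) (fun _ j => hy j)
    hSm hpm hqm ?_ ?_ ht
  · intro M u hu
    rw [le_neg]
    refine partialSups_le _ _ _ fun i hi => neg_le_neg ?_
    obtain ⟨j, hj⟩ := hu ⟨i, Nat.lt_succ_iff.2 hi⟩
    exact hj.trans (inner_le_norm_proj D _ ⟨ys j, hyD j, hy j⟩)
  · intro g h i
    obtain ⟨j, hj, h1⟩ := exists_le_eq_partialSups (fun j => ⟪ys j, g⟫) l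
    refine ⟨⟨j, Nat.lt_succ_iff.2 hj⟩, sub_le_sub h1.ge ?_⟩
    exact inner_le_norm_proj C h ⟨xs i, hxC i, (hx i).le⟩

/-- The smallest restricted singular value of a Gaussian matrix is sub-Gaussian from below about
`w(D) - w(C)`. -/
theorem lintegral_exp_neg_realSing_le {t : ℝ} (ht : 0 < t) :
    ∫⁻ M, ENNReal.ofReal (Real.exp (-t * realSing C D M)) ∂(matGaussian n m) ≤
      ENNReal.ofReal (Real.exp (-t * (gaussianWidth D - gaussianWidth C) + t ^ 2 / 2)) := by
  let xs : ℕ → EuclideanSpace ℝ (Fin m) := fun i => TopologicalSpace.denseSeq (ConeSphere C) i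
  let ys : ℕ → EuclideanSpace ℝ (Fin n) := fun j => TopologicalSpace.denseSeq (ConeBall D) j
  have hxC : ∀ i, xs i ∈ C := fun i => (TopologicalSpace.denseSeq (ConeSphere C) i).2.1
  have hx : ∀ i, ‖xs i‖ = 1 := fun i => (TopologicalSpace.denseSeq (ConeSphere C) i).2.2
  have hyD : ∀ j, ys j ∈ D := fun j => (TopologicalSpace.denseSeq (ConeBall D) j).2.1
  have hy : ∀ j, ‖ys j‖ ≤ 1 := fun j => (TopologicalSpace.denseSeq (ConeBall D) j).2.2
  have hxlim : ∀ M : Matrix (Fin n) (Fin m) ℝ, Tendsto (fun k => -partialSups (fun i =>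
      -‖proj D (Matrix.toEuclideanLin M (xs i))‖) k) atTop (𝓝 (realSing C D M)) :=
    tendsto_neg_partialSups_realSing C D
  have hylim : ∀ g, IsLUB (Set.range fun j => ⟪ys j, g⟫) ‖proj D g‖ := isLUB_inner_denseSeq D
  clear_value xs ys
  let Sk : ℕ → Matrix (Fin n) (Fin m) ℝ → ℝ := fun k M =>
    -partialSups (fun i => -‖proj D (Matrix.toEuclideanLin M (xs i))‖) k
  have hSk : ∀ k, Measurable (Sk k) := fun k =>
    (measurable_partialSups (fun i => (measurable_norm_proj_toEuclideanLin D _).neg) k).neg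
  let pl : ℕ → EuclideanSpace ℝ (Fin n) → ℝ := fun l g => partialSups (fun j => ⟪ys j, g⟫) l
  have hpl : ∀ l, Measurable (pl l) := fun l => measurable_partialSups (fun j => by fun_prop) l
  have hlim : Tendsto (fun l => ∫⁻ g, ENNReal.ofReal (Real.exp (-t * pl l g))
      ∂(stdGaussian (EuclideanSpace ℝ (Fin n)))) atTop
      (𝓝 (∫⁻ g, ENNReal.ofReal (Real.exp (-t * ‖proj D g‖))
        ∂(stdGaussian (EuclideanSpace ℝ (Fin n))))) := by
    -- The finite maxima lie below their limit, so exp(-t ·) approaches its limit from above and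
    -- Fatou would point the wrong way. Every maximum is at least its first term, which is at least
    -- -‖g‖; ‖g‖ is written as a projection onto the full space so that its exponential moment is
    -- known to be finite.
    refine tendsto_lintegral_of_dominated_convergence
      (fun g => ENNReal.ofReal (Real.exp (t * ‖proj ⊤ g‖))) (fun l => by have := hpl l; fun_prop)
      (fun l => ae_of_all _ fun g => ?_)
      ((lintegral_exp_norm_proj_le ⊤ t).trans_lt ENNReal.ofReal_lt_top).ne
      (ae_of_all _ fun g => tendsto_ofReal_exp_mul
        (tendsto_partialSups (hylim g)) (-t))
    refine ENNReal.ofReal_le_ofReal (Real.exp_le_exp.2 ?_)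
    rw [proj_top, neg_mul, ← mul_neg]
    refine mul_le_mul_of_nonneg_left ?_ ht.le
    have h1 : ⟪ys 0, g⟫ ≤ pl l g := le_partialSups_of_le (fun j => ⟪ys j, g⟫) (Nat.zero_le l)
    have h2 := neg_le_of_abs_le (abs_real_inner_le_norm (ys 0) g)
    have h3 : ‖ys 0‖ * ‖g‖ ≤ ‖g‖ := mul_le_of_le_one_left (norm_nonneg _) (hy 0)
    linarith
  have hk : ∀ k, ∫⁻ M, ENNReal.ofReal (Real.exp (-t * Sk k M)) ∂(matGaussian n m) ≤
      ENNReal.ofReal (Real.exp (-t * (gaussianWidth D - gaussianWidth C) + t ^ 2 / 2)) := by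
    intro k
    have hQ := lintegral_exp_norm_proj_le C t
    -- First l tends to infinity with k fixed; the limit in k is taken last, by Fatou.
    have h1 := ge_of_tendsto' (ENNReal.Tendsto.mul_const hlim
      (Or.inr (hQ.trans_lt ENNReal.ofReal_lt_top).ne)) (fun l => lintegral_exp_neg_partialSups_le C D hxC hx hyD hy k l ht)
    have h2 := h1.trans (mul_le_mul' (lintegral_exp_norm_proj_le D (-t)) hQ)
    rw [← ENNReal.ofReal_mul (Real.exp_pos _).le, ← Real.exp_add] at h2
    refine (le_of_mul_ofReal_exp_le h2).trans_eq ?_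
    congr 2
    ring
  exact lintegral_le_of_tendsto (fun k => ((hSk k).const_mul (-t)).exp.ennreal_ofReal)
    (fun M => tendsto_ofReal_exp_mul (hxlim M) (-t)) hk

end Cones

/-! ### The operator norm is sub-Gaussian from above. -/

section OperatorNorm

variable {n m : ℕ}

variable (n m) in
/-- Pairs of a unit vector of `ℝᵐ` and a vector of the unit ball of `ℝⁿ`. -/
abbrev SphereBall : Type :=
  ConeSphere (⊤ : ProperCone ℝ (EuclideanSpace ℝ (Fin m))) ×
    ConeBall (⊤ : ProperCone ℝ (EuclideanSpace ℝ (Fin n)))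

theorem inner_le_norm_toContinuousLinearMap (M : Matrix (Fin n) (Fin m) ℝ) (z : SphereBall n m) :
    ⟪(z.2 : EuclideanSpace ℝ (Fin n)), Matrix.toEuclideanLin M z.1⟫ ≤
      ‖LinearMap.toContinuousLinearMap (Matrix.toEuclideanLin M)‖ := by
  have h1 := (LinearMap.toContinuousLinearMap (Matrix.toEuclideanLin M)).le_opNorm
    (z.1 : EuclideanSpace ℝ (Fin m))
  rw [z.1.2.2, mul_one] at h1
  exact (real_inner_le_norm _ _).trans ((mul_le_of_le_one_left (norm_nonneg _) z.2.2.2).trans h1)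

/-- The degenerate case of Gordon with one vector per row: negating y turns the minimum over rows
into minus the maximum of the bilinear form, and -‖g‖ - ‖h‖ is a lower bound for the comparison
process. -/
theorem lintegral_exp_partialSups_le {xs : ℕ → EuclideanSpace ℝ (Fin m)}
    {ys : ℕ → EuclideanSpace ℝ (Fin n)} (hx : ∀ i, ‖xs i‖ = 1) (hy : ∀ i, ‖ys i‖ ≤ 1) (k : ℕ)
    {t : ℝ} (ht : 0 < t) :
    (∫⁻ M, ENNReal.ofReal (Real.exp (-t * -partialSups (fun i =>
        ⟪ys i, Matrix.toEuclideanLin M (xs i)⟫) k)) ∂(matGaussian n m)) *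
        ENNReal.ofReal (Real.exp (t ^ 2 / 2)) ≤
      (∫⁻ g, ENNReal.ofReal (Real.exp (-t * -‖g‖)) ∂(stdGaussian (EuclideanSpace ℝ (Fin n)))) *
        ∫⁻ h, ENNReal.ofReal (Real.exp (t * ‖h‖))
          ∂(stdGaussian (EuclideanSpace ℝ (Fin m))) := by
  have hSm : Measurable fun M : Matrix (Fin n) (Fin m) ℝ => -partialSups (fun i =>
      ⟪ys i, Matrix.toEuclideanLin M (xs i)⟫) k :=
    (measurable_partialSups (fun i => measurable_inner_toEuclideanLin _ _) k).neg
  refine lintegral_exp_neg_le_of_gordon (I := Fin (k + 1)) (J := Unit)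
    (x := fun i => xs i) (y := fun i _ => -ys i)
    (fun i => hx i) (fun i _ => by rw [norm_neg]; exact hy i)
    hSm measurable_norm.neg measurable_norm ?_ ?_ ht
  · intro M u hu
    rw [le_neg]
    refine partialSups_le _ _ _ fun i hi => ?_
    obtain ⟨_, hj⟩ := hu ⟨i, Nat.lt_succ_iff.2 hi⟩
    rw [inner_neg_left] at hj
    exact le_neg.1 hj
  · intro g h i
    have h2 : ⟪ys i, g⟫ ≤ ‖g‖ :=
      (real_inner_le_norm _ _).trans (mul_le_of_le_one_left (norm_nonneg _) (hy i))
    have h3 : ⟪xs i, h⟫ ≤ ‖h‖ :=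
      (real_inner_le_norm _ _).trans (mul_le_of_le_one_left (norm_nonneg _) (hx i).le)
    exact ⟨(), by rw [inner_neg_left]; exact sub_le_sub (neg_le_neg h2) h3⟩

variable [Nonempty (ConeSphere (⊤ : ProperCone ℝ (EuclideanSpace ℝ (Fin m))))]

/-- The operator norm, as the supremum of a bilinear form over a countable dense set. -/
def realOpNorm (M : Matrix (Fin n) (Fin m) ℝ) : ℝ :=
  ⨆ i, ⟪((TopologicalSpace.denseSeq (SphereBall n m) i).2 : EuclideanSpace ℝ (Fin n)),
    Matrix.toEuclideanLin M (TopologicalSpace.denseSeq (SphereBall n m) i).1⟫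

theorem bddAbove_inner_denseSeq (M : Matrix (Fin n) (Fin m) ℝ) : BddAbove (Set.range fun i =>
    ⟪((TopologicalSpace.denseSeq (SphereBall n m) i).2 : EuclideanSpace ℝ (Fin n)),
      Matrix.toEuclideanLin M (TopologicalSpace.denseSeq (SphereBall n m) i).1⟫) :=
  ⟨_, Set.forall_mem_range.2 fun _ => inner_le_norm_toContinuousLinearMap M _⟩

theorem measurable_realOpNorm :
    Measurable (realOpNorm : Matrix (Fin n) (Fin m) ℝ → ℝ) :=
  Measurable.iSup fun _ => measurable_inner_toEuclideanLin _ _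

theorem inner_le_realOpNorm (M : Matrix (Fin n) (Fin m) ℝ) (z : SphereBall n m) :
    ⟪(z.2 : EuclideanSpace ℝ (Fin n)), Matrix.toEuclideanLin M z.1⟫ ≤ realOpNorm M := by
  have hM := (Matrix.toEuclideanLin M).continuous_of_finiteDimensional
  exact le_ciSup_denseSeq (X := SphereBall n m) (f := fun z : SphereBall n m =>
    ⟪(z.2 : EuclideanSpace ℝ (Fin n)), Matrix.toEuclideanLin M z.1⟫)
    ((continuous_subtype_val.comp continuous_snd).inner
      (hM.comp (continuous_subtype_val.comp continuous_fst)))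
    ⟨_, Set.forall_mem_range.2 (inner_le_norm_toContinuousLinearMap M)⟩ z

theorem realOpNorm_nonneg (M : Matrix (Fin n) (Fin m) ℝ) : 0 ≤ realOpNorm M := by
  have x : ConeSphere (⊤ : ProperCone ℝ (EuclideanSpace ℝ (Fin m))) := Classical.arbitrary _
  simpa using inner_le_realOpNorm M (x, ⟨0, trivial, by simp⟩)

theorem opNorm_le_realOpNorm (M : Matrix (Fin n) (Fin m) ℝ) :
    opNorm M ≤ ENNReal.ofReal (realOpNorm M) := by
  rw [opNorm, ← ofReal_norm]
  refine ENNReal.ofReal_le_ofReal (ContinuousLinearMap.opNorm_le_bound _ (realOpNorm_nonneg M)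
    fun x => ?_)
  by_cases hx : x = 0
  · simp [hx]
  have hpos : 0 < ‖x‖ := norm_pos_iff.2 hx
  obtain ⟨y, hy⟩ := exists_inner_eq_norm_proj ⊤ (Matrix.toEuclideanLin M (‖x‖⁻¹ • x))
  rw [proj_top] at hy
  have h := inner_le_realOpNorm M (⟨‖x‖⁻¹ • x, trivial, by
    rw [norm_smul, norm_inv, norm_norm, inv_mul_cancel₀ hpos.ne']⟩, y)
  change ⟪(y : EuclideanSpace ℝ (Fin n)), Matrix.toEuclideanLin M (‖x‖⁻¹ • x)⟫ ≤ _ at h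
  rw [hy, map_smul, norm_smul, norm_inv, norm_norm] at h
  rwa [inv_mul_le_iff₀ hpos, mul_comm] at h

/-- The operator norm of a Gaussian matrix is sub-Gaussian from above about
`w(ℝⁿ) + w(ℝᵐ)`. -/
theorem lintegral_exp_realOpNorm_le {t : ℝ} (ht : 0 < t) :
    ∫⁻ M, ENNReal.ofReal (Real.exp (t * realOpNorm M)) ∂(matGaussian n m) ≤
      ENNReal.ofReal (Real.exp
        (t * (gaussianWidth (⊤ : ProperCone ℝ (EuclideanSpace ℝ (Fin n))) +
          gaussianWidth (⊤ : ProperCone ℝ (EuclideanSpace ℝ (Fin m)))) + t ^ 2 / 2)) := by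
  let xs : ℕ → EuclideanSpace ℝ (Fin m) := fun i => (TopologicalSpace.denseSeq (SphereBall n m) i).1
  let ys : ℕ → EuclideanSpace ℝ (Fin n) := fun i => (TopologicalSpace.denseSeq (SphereBall n m) i).2
  have hx : ∀ i, ‖xs i‖ = 1 := fun i => (TopologicalSpace.denseSeq (SphereBall n m) i).1.2.2
  have hy : ∀ i, ‖ys i‖ ≤ 1 := fun i => (TopologicalSpace.denseSeq (SphereBall n m) i).2.2.2
  have hlim : ∀ M : Matrix (Fin n) (Fin m) ℝ, IsLUB (Set.range fun i =>
      ⟪ys i, Matrix.toEuclideanLin M (xs i)⟫) (realOpNorm M) := fun M =>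
    isLUB_ciSup (bddAbove_inner_denseSeq M)
  clear_value xs ys
  have hNk : ∀ k, Measurable fun M : Matrix (Fin n) (Fin m) ℝ => partialSups (fun i =>
      ⟪ys i, Matrix.toEuclideanLin M (xs i)⟫) k := fun k =>
    measurable_partialSups (fun i => measurable_inner_toEuclideanLin _ _) k
  refine lintegral_le_of_tendsto (fun k => ((hNk k).const_mul t).exp.ennreal_ofReal)
    (fun M => tendsto_ofReal_exp_mul (tendsto_partialSups (hlim M)) t) fun k => ?_
  have h1 := lintegral_exp_partialSups_le hx hy k ht
  have hw := fun j : ℕ =>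
    lintegral_exp_norm_proj_le (⊤ : ProperCone ℝ (EuclideanSpace ℝ (Fin j))) t
  simp only [proj_top] at hw
  simp only [neg_mul_neg] at h1
  have h2 := h1.trans (mul_le_mul' (hw n) (hw m))
  rw [← ENNReal.ofReal_mul (Real.exp_pos _).le, ← Real.exp_add] at h2
  refine (le_of_mul_ofReal_exp_le h2).trans_eq ?_
  congr 2
  ring

end OperatorNorm

/-! ### Chernoff bounds, including a strict one. -/

section Tail

variable {α : Type*} [MeasurableSpace α] {μ : Measure α}

/-- The Chernoff bound for a sub-Gaussian variable. -/
theorem measure_ge_le_of_lintegral_exp_le {f : α → ℝ} {c : ℝ} (hf : Measurable f)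
    (h : ∀ t, 0 < t → ∫⁻ x, ENNReal.ofReal (Real.exp (t * f x)) ∂μ ≤
      ENNReal.ofReal (Real.exp (t * c + t ^ 2 / 2))) {r : ℝ} (hr : 0 < r) :
    μ {x | c + r ≤ f x} ≤ ENNReal.ofReal (Real.exp (-r ^ 2 / 2)) := by
  have h1 := mul_meas_ge_le_lintegral (μ := μ)
    (f := fun x => ENNReal.ofReal (Real.exp (r * f x))) (by fun_prop)
    (ENNReal.ofReal (Real.exp (r * (c + r))))
  have h2 : μ {x | c + r ≤ f x} ≤ μ {x | ENNReal.ofReal (Real.exp (r * (c + r))) ≤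
      ENNReal.ofReal (Real.exp (r * f x))} := measure_mono fun x hx =>
    ENNReal.ofReal_le_ofReal (Real.exp_le_exp.2 (mul_le_mul_of_nonneg_left hx hr.le))
  have h3 : μ {x | c + r ≤ f x} * ENNReal.ofReal (Real.exp (r * (c + r))) ≤
      ENNReal.ofReal (Real.exp (r * c + r ^ 2 / 2)) := by
    rw [mul_comm]
    exact (mul_le_mul_right h2 _).trans (h1.trans (h r hr))
  refine (le_of_mul_ofReal_exp_le h3).trans_eq ?_
  congr 2
  ring

/-- The Chernoff bound is strict. -/
theorem measure_ge_lt_of_lintegral_exp_le [IsProbabilityMeasure μ] {f : α → ℝ} {c : ℝ} (hf : Measurable f)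
    (h : ∀ t, 0 < t → ∫⁻ x, ENNReal.ofReal (Real.exp (t * f x)) ∂μ ≤
      ENNReal.ofReal (Real.exp (t * c + t ^ 2 / 2))) {r : ℝ} (hr : 0 < r) :
    μ {x | c + r ≤ f x} < ENNReal.ofReal (Real.exp (-r ^ 2 / 2)) := by
  have hle := measure_ge_le_of_lintegral_exp_le hf h hr
  set A := {x | c + r ≤ f x} with hA
  have hAm : MeasurableSet A := measurableSet_le measurable_const hf
  have hlt1 : μ A < 1 := by
    refine hle.trans_lt ?_
    rw [ENNReal.ofReal_lt_one, Real.exp_lt_one_iff]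
    have := sq_pos_of_pos hr
    linarith
  have hF : Measurable fun x => ENNReal.ofReal (Real.exp (r * f x)) := by fun_prop
  -- Markov's inequality discards the integral over the complement of the tail event. The weak bound
  -- already gives that complement positive mass, and the integrand is positive, so the loss is
  -- strict.
  have hcompl : μ Aᶜ ≠ 0 := by
    rw [prob_compl_eq_one_sub hAm]
    exact (tsub_pos_of_lt hlt1).ne'
  have hpos : ∫⁻ x in Aᶜ, ENNReal.ofReal (Real.exp (r * f x)) ∂μ ≠ 0 := by
    refine (setLIntegral_pos_iff hF).2 ?_ |>.ne'
    rw [Function.support_eq_univ fun x => (ENNReal.ofReal_pos.2 (Real.exp_pos _)).ne',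
      Set.univ_inter]
    exact pos_iff_ne_zero.2 hcompl
  have hA1 : ENNReal.ofReal (Real.exp (r * (c + r))) * μ A ≤
      ∫⁻ x in A, ENNReal.ofReal (Real.exp (r * f x)) ∂μ := by
    rw [← setLIntegral_const]
    exact setLIntegral_mono' hAm fun x hx => ENNReal.ofReal_le_ofReal
      (Real.exp_le_exp.2 (mul_le_mul_of_nonneg_left hx hr.le))
  have hsum := lintegral_add_compl (μ := μ)
    (fun x => ENNReal.ofReal (Real.exp (r * f x))) hAm
  have hbound := h r hr
  rw [← hsum] at hbound
  have hlt : ENNReal.ofReal (Real.exp (r * (c + r))) * μ A <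
      ENNReal.ofReal (Real.exp (r * c + r ^ 2 / 2)) := by
    refine (ENNReal.lt_add_right ?_ hpos).trans_le ((add_le_add_left hA1 _).trans hbound)
    exact ENNReal.mul_ne_top ENNReal.ofReal_ne_top (measure_ne_top _ _)
  refine lt_of_le_of_ne hle fun heq => hlt.ne ?_
  rw [heq, ← ENNReal.ofReal_mul (Real.exp_pos _).le, ← Real.exp_add]
  congr 2
  ring

end Tail

/-! ### From tail bounds to the conditional mean of a quotient. -/

section ExpectedQuotient

theorem integral_two_div_sq {c x : ℝ} (hx : 0 ≤ x) (hxc : x < c) :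
    ∫ r in (0 : ℝ)..x, 2 / (c - r) ^ 2 = 2 / (c - x) - 2 / c := by
  have hd : ∀ r ∈ Set.uIcc 0 x, HasDerivAt (fun r => 2 / (c - r)) (2 / (c - r) ^ 2) r := by
    intro r hr
    rw [Set.uIcc_of_le hx] at hr
    have hne : c - r ≠ 0 := by linarith [hr.2]
    refine ((hasDerivAt_const r (2 : ℝ)).div ((hasDerivAt_id r).const_sub c) hne).congr_deriv ?_
    simp
  have hcont : ContinuousOn (fun r : ℝ => 2 / (c - r) ^ 2) (Set.uIcc 0 x) := by
    refine ContinuousOn.div (by fun_prop) (by fun_prop) fun r hr => ?_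
    rw [Set.uIcc_of_le hx] at hr
    have : 0 < c - r := by linarith [hr.2]
    positivity
  rw [intervalIntegral.integral_eq_sub_of_hasDerivAt hd hcont.intervalIntegrable, sub_zero]

variable {α : Type*} [MeasurableSpace α] {μ : Measure α} [IsProbabilityMeasure μ]

/-- Bounding the expectation of a quotient `N / S`, away from the event that `N` is large or `S` is
small, by tail bounds for `N` and `S`. -/
theorem setLIntegral_le_of_tail {N S : α → ℝ} (hN : Measurable N) (hS : Measurable S) {W δ : ℝ}
    (hδ : 0 < δ) (hW : 0 ≤ W)
    (hNt : ∀ r, 0 < r → μ {x | W + r ≤ N x} ≤ ENNReal.ofReal (Real.exp (-r ^ 2 / 2)))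
    (hSt : ∀ r, 0 < r → μ {x | S x ≤ δ - r} ≤ ENNReal.ofReal (Real.exp (-r ^ 2 / 2)))
    {κ : α → ℝ≥0∞} (hκ : ∀ x, 0 < S x → κ x ≤ ENNReal.ofReal (N x / S x))
    {E : Set α} (hE : E = {x | W + δ / 2 ≤ N x} ∪ {x | S x ≤ δ / 2})
    {a b : ℝ} (ha : a = 1 / 2 * (W + δ)) (hb : b = 1 / 2 * (W - δ)) :
    ∫⁻ x in Eᶜ, κ x ∂μ ≤ ENNReal.ofReal (W / δ + 4 * ∫ s in (b / a)..((a + b) / (2 * a)),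
      Real.exp (-(a * s - b) ^ 2 / 2) / (1 - s) ^ 2) := by
  classical
  have ha0 : 0 < a := by rw [ha]; linarith
  have hEm : MeasurableSet E := by
    rw [hE]
    exact (measurableSet_le measurable_const hN).union (measurableSet_le hS measurable_const)
  -- In units of a, the full gap δ is `c` and the admissible deviation δ/2 is `R` = c/2, so c - r
  -- stays at least `R` for deviations up to `R`.
  set c := 1 - b / a with hc
  have hcδ : c = δ / a := by
    rw [hc]
    field_simp
    rw [ha, hb]
    ring
  set R := δ / (2 * a) with hR
  have hR0 : 0 < R := by positivity
  have hcR : c - R = R := by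
    rw [hcδ, hR]
    field_simp
    ring
  let T : α → ℝ := fun x => max (max (N x - W) (δ - S x)) 0
  have hT : Measurable T := ((hN.sub_const W).max (hS.const_sub δ)).max measurable_const
  let f : α → ℝ := E.piecewise (fun _ => 0) fun x => T x / a
  have hfm : Measurable f := Measurable.piecewise hEm measurable_const (hT.div_const a)
  have hT0 : ∀ x, 0 ≤ T x := fun x => le_max_right _ _
  have hf0 : ∀ x, 0 ≤ f x := fun x => by
    by_cases hx : x ∈ E
    · simp [f, hx]
    · simp only [f, Set.piecewise_eq_of_notMem _ _ _ hx]
      have := hT0 x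
      positivity
  have hTE : ∀ x, x ∉ E → T x < δ / 2 := by
    intro x hx
    rw [hE, Set.mem_union, not_or] at hx
    have h1 : ¬ W + δ / 2 ≤ N x := hx.1
    have h2 : ¬ S x ≤ δ / 2 := hx.2
    push Not at h1 h2
    refine max_lt (max_lt ?_ ?_) ?_ <;> linarith
  have hfR : ∀ x, f x < R := fun x => by
    by_cases hx : x ∈ E
    · simpa [f, hx] using hR0
    · simp only [f, Set.piecewise_eq_of_notMem _ _ _ hx]
      rw [hR, div_lt_iff₀ ha0]
      have := hTE x hx
      have e : δ / (2 * a) * a = δ / 2 := by field_simp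
      linarith
  -- Truncation at `R` removes the pole at c and makes the weight continuous everywhere; it changes
  -- nothing on the range of `f`.
  let g : ℝ → ℝ := fun r => 2 / (c - min r R) ^ 2
  have hgpos : ∀ r, 0 < c - min r R := fun r => by
    have := min_le_right r R
    linarith
  have hg : Continuous g :=
    Continuous.div continuous_const (by fun_prop) fun r => (pow_pos (hgpos r) 2).ne'
  have hg0 : ∀ r, 0 ≤ g r := fun r => by
    have := hgpos r
    positivity
  have hfint : ∀ x, ∫ r in (0 : ℝ)..f x, g r = 2 / (c - f x) - 2 / c := fun x => by
    rw [← integral_two_div_sq (hf0 x) (by linarith [hfR x])]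
    refine intervalIntegral.integral_congr fun r hr => ?_
    rw [Set.uIcc_of_le (hf0 x)] at hr
    simp only [g, min_eq_left (hr.2.trans (hfR x).le)]
  have hκf : ∀ x ∈ Eᶜ, κ x ≤ ENNReal.ofReal (W / δ) +
      ENNReal.ofReal (∫ r in (0 : ℝ)..f x, g r) := by
    intro x hx
    have hTx := hTE x hx
    have h1 : N x ≤ W + T x := by
      have := (le_max_left (N x - W) (δ - S x)).trans (le_max_left _ (0 : ℝ))
      linarith
    have h2 : δ - T x ≤ S x := by
      have := (le_max_right (N x - W) (δ - S x)).trans (le_max_left _ (0 : ℝ))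
      linarith
    have hpos : 0 < δ - T x := by linarith
    rw [← ENNReal.ofReal_add (by positivity)
      (intervalIntegral.integral_nonneg (hf0 x) fun r _ => hg0 r)]
    refine (hκ x (hpos.trans_le h2)).trans (ENNReal.ofReal_le_ofReal ?_)
    have h3 : f x = T x / a := Set.piecewise_eq_of_notMem _ _ _ hx
    -- Since W + δ = 2a, the bound equals 2/(c - f) - 1, whose value at f = 0 is W/δ and whose
    -- derivative is 2/(c - r)².
    calc N x / S x ≤ (W + T x) / (δ - T x) :=
          div_le_div₀ (by linarith [hT0 x]) h1 hpos h2
      _ = W / δ + ∫ r in (0 : ℝ)..f x, g r := by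
          rw [hfint, h3, hcδ, ← sub_div]
          have := hpos.ne'
          field_simp
          rw [ha]
          ring
  -- The factor 4 is the 2 of the weight times the 2 of the union bound over the deviations of N and
  -- S.
  have htail : ∀ r ∈ Set.Ioi (0 : ℝ), μ {x | r < f x} * ENNReal.ofReal (g r) ≤
      (Set.Ioc 0 R).indicator (fun r => ENNReal.ofReal
        (4 * (Real.exp (-(a * r) ^ 2 / 2) / (c - r) ^ 2))) r := by
    intro r hr
    have hr0 : 0 < r := hr
    by_cases hrR : r ≤ R
    · rw [Set.indicator_of_mem (Set.mem_Ioc.2 ⟨hr0, hrR⟩)]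
      have hsub : {x | r < f x} ⊆ {x | W + a * r ≤ N x} ∪ {x | S x ≤ δ - a * r} := by
        intro x hx
        have hx' : r < f x := hx
        by_cases hxE : x ∈ E
        · simp only [f, Set.piecewise_eq_of_mem _ _ _ hxE] at hx'
          linarith
        · simp only [f, Set.piecewise_eq_of_notMem _ _ _ hxE] at hx'
          rw [lt_div_iff₀ ha0, mul_comm] at hx'
          have har : 0 < a * r := by positivity
          rcases lt_max_iff.1 hx' with h | h
          · rcases lt_max_iff.1 h with h | h
            · left
              change W + a * r ≤ N x
              linarith
            · right
              change S x ≤ δ - a * r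
              linarith
          · linarith
      have hμ : μ {x | r < f x} ≤ ENNReal.ofReal (2 * Real.exp (-(a * r) ^ 2 / 2)) := by
        refine (measure_mono hsub).trans ((measure_union_le _ _).trans
          ((add_le_add (hNt _ (by positivity)) (hSt _ (by positivity))).trans_eq ?_))
        rw [← ENNReal.ofReal_add (Real.exp_pos _).le (Real.exp_pos _).le, two_mul]
      refine (mul_le_mul_left hμ _).trans_eq ?_
      rw [← ENNReal.ofReal_mul (by positivity)]
      simp only [g, min_eq_left hrR]
      congr 1
      ring
    · have : {x | r < f x} = ∅ := by
        ext x
        simp only [Set.mem_empty_iff_false, iff_false]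
        change ¬ r < f x
        linarith [hfR x]
      rw [this, measure_empty, zero_mul]
      exact zero_le
  have hcont : ContinuousOn (fun r => 4 * (Real.exp (-(a * r) ^ 2 / 2) / (c - r) ^ 2))
      (Set.Icc 0 R) := by
    refine continuousOn_const.mul (ContinuousOn.div (by fun_prop) (by fun_prop) fun r hr => ?_)
    have : 0 < c - r := by linarith [hr.2]
    positivity
  have hI : ∫ r in (0 : ℝ)..R, 4 * (Real.exp (-(a * r) ^ 2 / 2) / (c - r) ^ 2) =
      4 * ∫ s in (b / a)..((a + b) / (2 * a)),
        Real.exp (-(a * s - b) ^ 2 / 2) / (1 - s) ^ 2 := by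
    rw [intervalIntegral.integral_const_mul]
    congr 1
    -- The substitution s = r + b/a turns ar into as - b and c - r into 1 - s.
    have h := intervalIntegral.integral_comp_add_right (a := 0) (b := R)
      (fun s => Real.exp (-(a * s - b) ^ 2 / 2) / (1 - s) ^ 2) (b / a)
    rw [zero_add, show R + b / a = (a + b) / (2 * a) by
      rw [hR]
      field_simp
      rw [ha, hb]
      ring] at h
    rw [← h]
    refine intervalIntegral.integral_congr fun r _ => ?_
    rw [show a * (r + b / a) - b = a * r by field_simp; ring,
      show 1 - (r + b / a) = c - r by rw [hc]; ring]
  calc ∫⁻ x in Eᶜ, κ x ∂μ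
      ≤ ∫⁻ x in Eᶜ, ENNReal.ofReal (W / δ) + ENNReal.ofReal (∫ r in (0 : ℝ)..f x, g r) ∂μ :=
        setLIntegral_mono' hEm.compl hκf
    _ ≤ ∫⁻ x, ENNReal.ofReal (W / δ) + ENNReal.ofReal (∫ r in (0 : ℝ)..f x, g r) ∂μ :=
        setLIntegral_le_lintegral _ _
    _ = ENNReal.ofReal (W / δ) + ∫⁻ x, ENNReal.ofReal (∫ r in (0 : ℝ)..f x, g r) ∂μ := by
        rw [lintegral_add_left measurable_const]
        simp
    _ = ENNReal.ofReal (W / δ) +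
          ∫⁻ r in Set.Ioi (0 : ℝ), μ {x | r < f x} * ENNReal.ofReal (g r) := by
        rw [lintegral_comp_eq_lintegral_meas_lt_mul μ (ae_of_all _ hf0) hfm.aemeasurable
          (fun t _ => hg.intervalIntegrable _ _) (ae_of_all _ hg0)]
    _ ≤ ENNReal.ofReal (W / δ) + ∫⁻ r, (Set.Ioc 0 R).indicator (fun r => ENNReal.ofReal
          (4 * (Real.exp (-(a * r) ^ 2 / 2) / (c - r) ^ 2))) r := by
        refine add_le_add le_rfl ?_
        exact (setLIntegral_mono' measurableSet_Ioi htail).trans (setLIntegral_le_lintegral _ _)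
    _ = ENNReal.ofReal (W / δ) + ENNReal.ofReal
          (∫ r in (0 : ℝ)..R, 4 * (Real.exp (-(a * r) ^ 2 / 2) / (c - r) ^ 2)) := by
        rw [lintegral_indicator measurableSet_Ioc, intervalIntegral.integral_of_le hR0.le,
          ofReal_integral_eq_lintegral_ofReal
            ((hcont.integrableOn_Icc).mono_set Set.Ioc_subset_Icc_self)
            (ae_of_all _ fun r => by positivity)]
    _ = _ := by
        rw [← ENNReal.ofReal_add (by positivity)
          (intervalIntegral.integral_nonneg hR0.le fun r _ => by positivity), hI]

/-- A strict bound for the expectation conditioned on the complement of an event. -/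
theorem lintegral_cond_compl_lt {E : Set α} (hE : MeasurableSet E) {κ : α → ℝ≥0∞} {ε B : ℝ}
    (hε : ε < 1) (hB : 0 < B) (hμ : μ E < ENNReal.ofReal ε)
    (hκ : ∫⁻ x in Eᶜ, κ x ∂μ ≤ ENNReal.ofReal B) :
    ∫⁻ x, κ x ∂(μ[|Eᶜ]) < ENNReal.ofReal (1 / (1 - ε) * B) := by
  have hε0 : 0 < ε := by
    by_contra h
    rw [ENNReal.ofReal_of_nonpos (not_lt.1 h)] at hμ
    exact absurd hμ not_lt_zero
  have hlt : ENNReal.ofReal (1 - ε) < μ Eᶜ := by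
    rwa [prob_compl_eq_one_sub hE, lt_tsub_comm, ← ENNReal.ofReal_one,
      ← ENNReal.ofReal_sub 1 (by linarith), sub_sub_cancel]
  rw [ProbabilityTheory.cond, lintegral_smul_measure, smul_eq_mul,
    ENNReal.ofReal_mul (by rw [one_div, inv_nonneg]; linarith)]
  -- The bound on the integral is only weak; strictness comes from normalising by a probability
  -- above 1 - ε, and survives multiplication because B is positive and finite.
  have hinv : (μ Eᶜ)⁻¹ < ENNReal.ofReal (1 / (1 - ε)) := by
    rw [one_div, ENNReal.ofReal_inv_of_pos (by linarith)]
    exact ENNReal.inv_lt_inv.2 hlt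
  calc (μ Eᶜ)⁻¹ * ∫⁻ x in Eᶜ, κ x ∂μ ≤ (μ Eᶜ)⁻¹ * ENNReal.ofReal B := by gcongr
    _ < ENNReal.ofReal (1 / (1 - ε)) * ENNReal.ofReal B :=
        ENNReal.mul_lt_mul_left (ENNReal.ofReal_pos.2 hB).ne' ENNReal.ofReal_ne_top hinv

end ExpectedQuotient

/-! ### Bounds on the condition number and the conclusion. -/

section Main

variable {n m : ℕ}

theorem gaussianWidth_nonneg {k : ℕ} (K : ProperCone ℝ (EuclideanSpace ℝ (Fin k))) :
    0 ≤ gaussianWidth K := integral_nonneg fun _ => norm_nonneg _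

theorem gaussianWidth_le_top {k : ℕ} (K : ProperCone ℝ (EuclideanSpace ℝ (Fin k))) :
    gaussianWidth K ≤ gaussianWidth (⊤ : ProperCone ℝ (EuclideanSpace ℝ (Fin k))) := by
  refine integral_mono (integrable_norm_proj K) (integrable_norm_proj ⊤) fun x => ?_
  simp only [proj_top]
  exact norm_proj_le K x

theorem ofReal_realSing_le_minSing (C : ProperCone ℝ (EuclideanSpace ℝ (Fin m)))
    (D : ProperCone ℝ (EuclideanSpace ℝ (Fin n))) [Nonempty (ConeSphere C)]
    (M : Matrix (Fin n) (Fin m) ℝ) : ENNReal.ofReal (realSing C D M) ≤ minSing C D M := by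
  refine le_iInf₂ fun x hx => ?_
  rw [← ofReal_norm]
  exact ENNReal.ofReal_le_ofReal (realSing_le C D M ⟨x, hx⟩)

theorem condNumber_le_ofReal (C : ProperCone ℝ (EuclideanSpace ℝ (Fin m)))
    (D : ProperCone ℝ (EuclideanSpace ℝ (Fin n))) [Nonempty (ConeSphere C)]
    [Nonempty (ConeSphere (⊤ : ProperCone ℝ (EuclideanSpace ℝ (Fin m))))]
    {M : Matrix (Fin n) (Fin m) ℝ} (hM : 0 < realSing C D M) :
    condNumber C D M ≤ ENNReal.ofReal (realOpNorm M / realSing C D M) := by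
  have hS := ofReal_realSing_le_minSing C D M
  have hpos : 0 < minSing C D M := (ENNReal.ofReal_pos.2 hM).trans_le hS
  refine (min_le_left _ _).trans ?_
  rw [quot, if_neg hpos.ne', ENNReal.ofReal_div_of_pos hM]
  exact ENNReal.div_le_div (opNorm_le_realOpNorm M) hS

theorem condNumber_eq_zero_of_isEmpty (C : ProperCone ℝ (EuclideanSpace ℝ (Fin m)))
    (D : ProperCone ℝ (EuclideanSpace ℝ (Fin n))) [IsEmpty (ConeSphere C)]
    (M : Matrix (Fin n) (Fin m) ℝ) : condNumber C D M = 0 := by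
  have h : minSing C D M = ⊤ := by
    simp only [minSing, iInf_eq_top]
    exact fun x hx => (IsEmpty.false (⟨x, hx⟩ : ConeSphere C)).elim
  have h2 : quot (opNorm M) (minSing C D M) = 0 := by
    rw [h, quot, if_neg ENNReal.top_ne_zero]
    exact ENNReal.div_top
  rw [condNumber, h2]
  exact min_eq_left zero_le

theorem bound_pos {W δ a b : ℝ} (hδ : 0 < δ) (hW : 0 < W) (ha : a = 1 / 2 * (W + δ))
    (hb : b = 1 / 2 * (W - δ)) :
    0 < W / δ + 4 * ∫ s in (b / a)..((a + b) / (2 * a)),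
      Real.exp (-(a * s - b) ^ 2 / 2) / (1 - s) ^ 2 := by
  have ha0 : 0 < a := by rw [ha]; positivity
  have h : b / a ≤ (a + b) / (2 * a) := by
    rw [div_le_div_iff₀ ha0 (by positivity)]
    have : b ≤ a := by rw [ha, hb]; linarith
    nlinarith
  have := intervalIntegral.integral_nonneg (μ := volume) h
    (f := fun s => Real.exp (-(a * s - b) ^ 2 / 2) / (1 - s) ^ 2) fun s _ => by positivity
  positivity

/-- The threshold gives δ²/8 > 1, and e > 2. -/
theorem two_mul_exp_lt_one {δ : ℝ} (hδ : 2 * √2 < δ) : 2 * Real.exp (-δ ^ 2 / 8) < 1 := by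
  have h1 : 8 < δ ^ 2 := by
    have h2 := Real.sq_sqrt (zero_le_two : (0 : ℝ) ≤ 2)
    nlinarith [Real.sqrt_nonneg 2]
  have h2 : Real.exp (-δ ^ 2 / 8) < Real.exp (-1) := Real.exp_lt_exp.2 (by linarith)
  have h3 : Real.exp (-1) * 2 < 1 := by
    have h4 := Real.add_one_lt_exp (one_ne_zero (α := ℝ))
    rw [Real.exp_neg, inv_mul_lt_iff₀ (Real.exp_pos 1)]
    linarith
  linarith

end Main

end Renegar

end

theorem mainTheorem4 {n m : ℕ}
    (C : ProperCone ℝ (EuclideanSpace ℝ (Fin m)))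
    (D : ProperCone ℝ (EuclideanSpace ℝ (Fin n)))
    (hw : 2 * Real.sqrt 2 < Renegar.gaussianWidth D - Renegar.gaussianWidth C)
    {Ω : Type*} [MeasurableSpace Ω] (P : Measure Ω) [IsProbabilityMeasure P]
    (G : Ω → Matrix (Fin n) (Fin m) ℝ) (hG : Renegar.IsGaussianMatrix G P)
    (wn wm ε a b : ℝ)
    (hwn : wn = Renegar.gaussianWidth (⊤ : ProperCone ℝ (EuclideanSpace ℝ (Fin n))))
    (hwm : wm = Renegar.gaussianWidth (⊤ : ProperCone ℝ (EuclideanSpace ℝ (Fin m))))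
    (hε : ε = 2 * Real.exp (-(Renegar.gaussianWidth D - Renegar.gaussianWidth C) ^ 2 / 8))
    (ha : a = (1 / 2) * (wm + wn + (Renegar.gaussianWidth D - Renegar.gaussianWidth C)))
    (hb : b = (1 / 2) * (wm + wn - (Renegar.gaussianWidth D - Renegar.gaussianWidth C))) :
    ∃ E : Set (Matrix (Fin n) (Fin m) ℝ), MeasurableSet E ∧
      P (G ⁻¹' E) < ENNReal.ofReal ε ∧
      ∫⁻ ω, Renegar.condNumber C D (G ω) ∂(P[|(G ⁻¹' E)ᶜ]) <
        ENNReal.ofReal ((1 / (1 - ε)) *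
          ((wn + wm) / (Renegar.gaussianWidth D - Renegar.gaussianWidth C) +
            4 * ∫ s in (b / a)..((a + b) / (2 * a)),
              Real.exp (-(a * s - b) ^ 2 / 2) / (1 - s) ^ 2)) := by
  set δ := Renegar.gaussianWidth D - Renegar.gaussianWidth C with hδdef
  have hδ : 0 < δ := lt_of_le_of_lt (by positivity) hw
  have hε1 : ε < 1 := hε ▸ Renegar.two_mul_exp_lt_one hw
  have hW : 0 < wn + wm := by
    have h1 := Renegar.gaussianWidth_le_top D
    have h2 := Renegar.gaussianWidth_nonneg C
    have h3 := Renegar.gaussianWidth_nonneg (⊤ : ProperCone ℝ (EuclideanSpace ℝ (Fin m)))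
    rw [← hwn] at h1
    rw [← hwm] at h3
    linarith
  rw [add_comm wm wn] at ha hb
  have hB := Renegar.bound_pos hδ hW ha hb
  have hε0 : 0 < ε := by
    rw [hε]
    positivity
  rcases isEmpty_or_nonempty (Renegar.ConeSphere C) with hC | hC
  -- For C = {0} the singular value is ∞ and the condition number 0, so nothing need be removed and
  -- a positive right-hand side suffices.
  · refine ⟨∅, MeasurableSet.empty, by simpa using hε0, ?_⟩
    simp only [Renegar.condNumber_eq_zero_of_isEmpty, lintegral_zero]
    exact ENNReal.ofReal_pos.2 (mul_pos (one_div_pos.2 (by linarith)) hB)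
  have hT : Nonempty (Renegar.ConeSphere (⊤ : ProperCone ℝ (EuclideanSpace ℝ (Fin m)))) :=
    let ⟨x, hx⟩ := hC
    ⟨⟨x, trivial, hx.2⟩⟩
  let N : Ω → ℝ := fun ω => Renegar.realOpNorm (G ω)
  let S : Ω → ℝ := fun ω => Renegar.realSing C D (G ω)
  have hNm : Measurable N := Renegar.measurable_realOpNorm.comp hG.measurable
  have hSm : Measurable S := (Renegar.measurable_realSing C D).comp hG.measurable
  have hNexp : ∀ t, 0 < t → ∫⁻ ω, ENNReal.ofReal (Real.exp (t * N ω)) ∂P ≤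
      ENNReal.ofReal (Real.exp (t * (wn + wm) + t ^ 2 / 2)) := fun t ht => by
    rw [hwn, hwm]
    have h := Renegar.lintegral_exp_realOpNorm_le (n := n) (m := m) ht
    rw [← hG.map_eq, lintegral_map (by
      have := Renegar.measurable_realOpNorm (n := n) (m := m)
      fun_prop) hG.measurable] at h
    exact h
  have hSexp : ∀ t, 0 < t → ∫⁻ ω, ENNReal.ofReal (Real.exp (t * -S ω)) ∂P ≤
      ENNReal.ofReal (Real.exp (t * -δ + t ^ 2 / 2)) := fun t ht => by
    have h := Renegar.lintegral_exp_neg_realSing_le C D ht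
    rw [← hG.map_eq, lintegral_map (by
      have := Renegar.measurable_realSing C D
      fun_prop) hG.measurable] at h
    simpa only [neg_mul, mul_neg] using h
  have hset : ∀ r, {ω | S ω ≤ δ - r} = {ω | -δ + r ≤ -S ω} := fun r => by
    ext ω
    change S ω ≤ δ - r ↔ -δ + r ≤ -S ω
    constructor <;> intro h <;> linarith
  have hNt := fun r hr => Renegar.measure_ge_le_of_lintegral_exp_le (r := r) hNm hNexp hr
  have hSt : ∀ r, 0 < r → P {ω | S ω ≤ δ - r} ≤ ENNReal.ofReal (Real.exp (-r ^ 2 / 2)) :=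
    fun r hr => by
      rw [hset]
      exact Renegar.measure_ge_le_of_lintegral_exp_le hSm.neg hSexp hr
  let E : Set (Matrix (Fin n) (Fin m) ℝ) :=
    {M | wn + wm + δ / 2 ≤ Renegar.realOpNorm M} ∪ {M | Renegar.realSing C D M ≤ δ / 2}
  have hE : MeasurableSet E :=
    (measurableSet_le measurable_const Renegar.measurable_realOpNorm).union
      (measurableSet_le (Renegar.measurable_realSing C D) measurable_const)
  -- Each deviation by δ/2 costs exp(-δ²/8). It is enough that one of the two bounds, here that for
  -- the operator norm, is strict.
  have hPE : P (G ⁻¹' E) < ENNReal.ofReal ε := by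
    have h1 := Renegar.measure_ge_lt_of_lintegral_exp_le hNm hNexp (half_pos hδ)
    have h2 := hSt (δ / 2) (half_pos hδ)
    rw [sub_half] at h2
    refine (measure_union_le {ω | wn + wm + δ / 2 ≤ N ω} {ω | S ω ≤ δ / 2}).trans_lt
      ((ENNReal.add_lt_add_of_lt_of_le (measure_ne_top _ _) h1 h2).trans_eq ?_)
    rw [← ENNReal.ofReal_add (Real.exp_pos _).le (Real.exp_pos _).le, ← two_mul, hε]
    congr 3
    ring
  refine ⟨E, hE, hPE, Renegar.lintegral_cond_compl_lt (hE.preimage hG.measurable) hε1 hB hPE ?_⟩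
  exact Renegar.setLIntegral_le_of_tail hNm hSm hδ hW.le hNt hSt
    (fun ω hω => Renegar.condNumber_le_ofReal C D hω) rfl ha hb
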